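/- **Model.** A link $i$ is a pair of a sender $s_i$ and a receiver $r_i$ in the plane, of length $l_i=d(s_i,r_i)$. All senders use power $P>0$. Let $\alpha>2$ be the path-loss exponent and $\beta\ge1$ the threshold. For a set $L$ of $n$ links we assume $s_j\ne r_i$ for all $i,j$, and put $\bar{\mathcal S}_i=P/l_i^{\alpha}$ and $\bar{\mathcal I}_{ji}=P/d(s_j,r_i)^{\alpha}$. A stochastic shadowing distribution $\mathcal D$ is a family $(\mathcal D_m)_{m>0}$ of probability distributions on $[0,\infty)$, where $\mathcal D_m$ has mean $m$. Under $\mathcal D$, the signal strengths $\mathcal S_i$ and the interferences $\mathcal I_{ji}$ ($j\neq i$) are independent random variables with laws $\mathcal D_{\bar{\mathcal S}_i}$ and $\mathcal D_{\bar{\mathcal I}_{ji}}$. A set $S\subseteq L$ is *feasible* if $\mathcal S_i>\beta\sum_{j\in S\setminus i}\mathcal I_{ji}$ for every $i\in S$, and $\mathrm{OPT}^{\mathcal D}(L)$ is the maximum size of a feasible subset of $L$. The *affectance* of $S$ on $j$ is $a_S(j)=\sum_{i\in S\setminus j}\mathcal I_{ij}/\mathcal S_j$. $\mathcal D$ is *$p$-smooth*,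 for $p\in(0,1)$, if there is $c_0>0$ such that for every $m>0$ there is $x\ge c_0m$ with $\mathcal D_m((x,\infty))=p$. Let $f_m(t)=\mathcal D_m((tm,\infty))$ and $g_n(m)=\max\{1,g'_n(m)\}$, where $g'_n(m)$ is the maximal (in general, the supremum; $0$ if there is none) $t\ge0$ with $f_m(t)\in[t/n,2t/n]$. The condition $g_n=\Omega(\log n)$ means that for some $\kappa>0$ and $N$, $g_n(m)\ge\kappa\log n$ for all $n\ge N$ and $m>0$. A set of links is *equilength* if $l_i<2l_j$ for all its links $i,j$. A *cluster* is an equilength set whose senders lie in a square of side half its minimum length. An equilength set is *well-separated* if it is a disjoint union of clusters such that $\min\{d(s_i,r_j),d(s_j,r_i)\}$ exceeds the minimum length of the set for all $i,j$ in different clusters. **Algorithm** (with a parameter $c>0$, for an equilength set $L$). 1. Cut the plane by a grid of horizontal and vertical lines, at any position, into half-open squares of side $\frac12\min_{i\in L}l_i$ with integer coordinates. Split $L$ into $81$ subsets according to the coordinates modulo $9$ of the square of the sender. In each subset, the links with senders in a common square form a cluster. 2. For each cluster $C$ of a subset $L'$, go through $C$ in decreasing order of signal strength (ties in the order of the link numbers)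 and add $i$ to $S_C$, initially empty, if $\mathcal S_i>2\beta|S_C|\,P/(\min_{j\in C}l_j)^{\alpha}$. Let $S=\bigcup_C S_C$ and $R=\{j\in S:\ a_S(j)<2c\}$. 3. Partition $R$ into at most $\lceil 4c\beta\rceil$ feasible sets in any way and let a largest of them be the solution for $L'$. 4. Output as $ALG$ a largest of the $81$ solutions. **Theorem.** Let $\alpha>2$, $\beta\ge1$, $p\in(0,1)$, and let $\mathcal D$ be a $p$-smooth shadowing distribution with $g_n=\Omega(\log n)$. There are constants $c,A,B>0$ (depending only on $\alpha,\beta,p,\mathcal D$) such that for every $P>0$, every $n$, every equilength set $L$ of $n$ links in the plane as above, and every position of the grid: the $81$ subsets of step 1 are well-separated, as the unions of their clusters; almost surely all steps of the algorithm with parameter $c$ can be carried out, and its output can be chosen as a random variable; and every random output $ALG$ satisfies $$A\cdot\mathbb E[\mathrm{OPT}^{\mathcal D}(L)]\ \le\ \mathbb E[|ALG|]\ \le\ B\cdot\mathbb E[\mathrm{OPT}^{\mathcal D}(L)],$$ that is, $\mathbb E[|ALG|]=\Theta(\mathbb E[\mathrm{OPT}^{\mathcal D}(L)])$. -/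

import Mathlib

open MeasureTheory ProbabilityTheory

noncomputable section

/-- The Euclidean plane. -/
abbrev Plane : Type := EuclideanSpace ℝ (Fin 2)

/-- `n` communication links, numbered by `Fin n`: link `i` is a sender node and a receiver node. -/
structure LinkSet (n : ℕ) where
  sender : Fin n → Plane
  receiver : Fin n → Plane

namespace LinkSet

variable {n : ℕ} (L : LinkSet n)

/-- The length of link `i`. -/
def len (i : Fin n) : ℝ := dist (L.sender i) (L.receiver i)

/-- The minimum length of the links in a (nonempty) set `T`. -/
def minLen (T : Finset (Fin n)) : ℝ := sInf (L.len '' (T : Set (Fin n)))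

/-- Geometric path-loss: the power received at the receiver of link `i` when the sender of link `j`
transmits with power `P`. For `j = i` it is the signal strength of link `i`, for `j ≠ i` it is the
interference of link `j` on link `i`. -/
def gain (P α : ℝ) (j i : Fin n) : ℝ := P / dist (L.sender j) (L.receiver i) ^ α

/-- The ratio of any two lengths of links in `T` is less than two. -/
def Equilength (T : Finset (Fin n)) : Prop := ∀ i ∈ T, ∀ j ∈ T, L.len i < 2 * L.len j

/-- An equilength set is a cluster if some square (with a vertex `a` and orthonormal side directions
`u`, `v`) of side length half the minimum link length contains all the sender nodes. -/
def IsCluster (T : Finset (Fin n)) : Prop :=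
  L.Equilength T ∧ ∃ a u v : Plane, ‖u‖ = 1 ∧ ‖v‖ = 1 ∧ inner ℝ u v = 0 ∧ ∀ i ∈ T,
    inner ℝ (L.sender i - a) u ∈ Set.Icc 0 (L.minLen T / 2) ∧
    inner ℝ (L.sender i - a) v ∈ Set.Icc 0 (L.minLen T / 2)

/-- The equilength set `T` is well-separated, as the disjoint union of the clusters in `𝒞`. -/
def IsWellSeparated (T : Finset (Fin n)) (𝒞 : Finset (Finset (Fin n))) : Prop :=
  L.Equilength T ∧ 𝒞.biUnion id = T ∧
  (∀ C ∈ 𝒞, L.IsCluster C) ∧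
  ∀ C ∈ 𝒞, ∀ C' ∈ 𝒞, C ≠ C' → Disjoint C C' ∧ ∀ i ∈ C, ∀ j ∈ C',
    L.minLen T < min (dist (L.sender i) (L.receiver j)) (dist (L.sender j) (L.receiver i))

/-- The plane is cut into (half-open) squares by horizontal and vertical lines at distance `ℓ / 2`,
where `ℓ` is the minimum link length; the grid is positioned by one of its vertices, `o`. This is the
pair of integer coordinates of the square that contains the sender of link `i`. -/
def square (o : Plane) (i : Fin n) : ℤ × ℤ :=
  (⌊(L.sender i 0 - o 0) / (L.minLen Finset.univ / 2)⌋,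
   ⌊(L.sender i 1 - o 1) / (L.minLen Finset.univ / 2)⌋)

/-- The links whose sender is in a square with coordinates congruent to `q` modulo 9: these are the 81
subsets into which the algorithm splits the links. -/
def gridClass (o : Plane) (q : ZMod 9 × ZMod 9) : Finset (Fin n) :=
  {i | (((L.square o i).1 : ZMod 9), ((L.square o i).2 : ZMod 9)) = q}

/-- The clusters of the subset `gridClass o q`: the links with senders in a common square. -/
def clusters (o : Plane) (q : ZMod 9 × ZMod 9) : Finset (Finset (Fin n)) :=
  (L.gridClass o q).image fun i => {j ∈ L.gridClass o q | L.square o j = L.square o i}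

end LinkSet

/-- A stochastic shadowing distribution: a distribution on the nonnegative reals that is parametrized
by its mean `m > 0`. -/
structure SSDistribution where
  law : ℝ → Measure ℝ
  isProbabilityMeasure : ∀ m, 0 < m → IsProbabilityMeasure (law m)
  nonneg : ∀ m, 0 < m → ∀ᵐ x ∂law m, 0 ≤ x
  integrable : ∀ m, 0 < m → Integrable (fun x => x) (law m)
  mean : ∀ m, 0 < m → ∫ x, x ∂law m = m

namespace SSDistribution

variable (D : SSDistribution)

/-- For a constant `c > 0`, the `(1 - p)`-quantile of the law of mean `m` is at least `c * m`. -/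
def IsSmooth (p : ℝ) : Prop :=
  ∃ c : ℝ, 0 < c ∧ ∀ m, 0 < m → ∃ x, (D.law m).real (Set.Ioi x) = p ∧ c * m ≤ x

/-- The probability `f t` that a power of mean `m` exceeds `t` times its mean. -/
def tail (m t : ℝ) : ℝ := (D.law m).real (Set.Ioi (t * m))

/-- `g n = max 1 g'`, where `g'` is the maximal `t ≥ 0` with `t / n ≤ f t ≤ 2 * t / n`. -/
def g (m : ℝ) (n : ℕ) : ℝ :=
  max 1 (sSup {t : ℝ | 0 ≤ t ∧ D.tail m t ∈ Set.Icc (t / n) (2 * t / n)})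

/-- `g n = Ω(log n)`, with constants that do not depend on the mean. -/
def HasLogGrowth : Prop :=
  ∃ κ : ℝ, 0 < κ ∧ ∃ N : ℕ, ∀ n ≥ N, ∀ m, 0 < m → κ * Real.log n ≤ D.g m n

end SSDistribution

/-! In the following, `x j i` is the power received at the receiver of link `i` from the sender of
link `j`: the signal strength of link `i` is `x i i`, the interference of `j` on `i ≠ j` is `x j i`. -/

section Algorithm

variable {n : ℕ}

/-- Every link of `S` has a signal to interference ratio greater than `β` when `S` transmits. -/
def IsFeasible (β : ℝ) (x : Fin n → Fin n → ℝ) (S : Finset (Fin n)) : Prop :=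
  ∀ i ∈ S, β * ∑ j ∈ S.erase i, x j i < x i i

open Classical in
/-- The maximum number of links in a feasible set. -/
def opt (β : ℝ) (x : Fin n → Fin n → ℝ) : ℕ :=
  (Finset.univ.filter fun S : Finset (Fin n) => IsFeasible β x S).sup Finset.card

/-- The affectance of `S` on link `j`. -/
def affectance (x : Fin n → Fin n → ℝ) (S : Finset (Fin n)) (j : Fin n) : ℝ :=
  ∑ i ∈ S.erase j, x i j / x j j

open Classical in
/-- The links of `T` in decreasing order of signal strength (ties are in the order of the numbers:
insertion sort is stable). -/
def byStrength (x : Fin n → Fin n → ℝ) (T : Finset (Fin n)) : List (Fin n) :=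
  (T.sort (· ≤ ·)).insertionSort fun i j => x j j ≤ x i i

open Classical in
/-- The set constructed by the cluster algorithm on `T`: in decreasing order of signal strength, link
`i` is added to `S` if its strength exceeds `2 * β * |S| * s`, where `s` is the path-loss signal
strength of a link of the minimum length in `T`. -/
def clusterSelect (L : LinkSet n) (P α β : ℝ) (x : Fin n → Fin n → ℝ) (T : Finset (Fin n)) :
    Finset (Fin n) :=
  (byStrength x T).foldl
    (fun S i => if 2 * β * (S.card : ℝ) * (P / L.minLen T ^ α) < x i i then insert i S else S) ∅

/-- The union of the sets that the cluster algorithm constructs on the clusters of one of the 81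
well-separated subsets. -/
def selected (L : LinkSet n) (P α β : ℝ) (o : Plane) (x : Fin n → Fin n → ℝ)
    (q : ZMod 9 × ZMod 9) : Finset (Fin n) :=
  (L.clusters o q).biUnion (clusterSelect L P α β x)

open Classical in
/-- The selected links on which the selected set has affectance less than `2 * c`. -/
def sparsified (L : LinkSet n) (P α β c : ℝ) (o : Plane) (x : Fin n → Fin n → ℝ)
    (q : ZMod 9 × ZMod 9) : Finset (Fin n) :=
  (selected L P α β o x q).filter fun j => affectance x (selected L P α β o x q) j < 2 * c

/-- `A` is a largest class of a partition of `R` into at most `k` feasible sets (the classes of the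
family may be empty). -/
def IsLargestFeasiblePart (β : ℝ) (x : Fin n → Fin n → ℝ) (k : ℕ) (R A : Finset (Fin n)) : Prop :=
  ∃ part : Fin k → Finset (Fin n),
    (∀ r r', r ≠ r' → Disjoint (part r) (part r')) ∧
    Finset.univ.biUnion part = R ∧
    (∀ r, IsFeasible β x (part r)) ∧
    (∃ r, A = part r) ∧ ∀ r, (part r).card ≤ A.card

/-- `A` is a possible output of the algorithm with parameter `c` on received powers `x`: for each of the
81 well-separated subsets, the sparsified set is partitioned into at most `⌈4 * c * β⌉` feasible sets,
the largest of them is the solution for that subset, and `A` is a solution of maximum size. -/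
def IsOutput (L : LinkSet n) (P α β c : ℝ) (o : Plane) (x : Fin n → Fin n → ℝ)
    (A : Finset (Fin n)) : Prop :=
  ∃ sol : ZMod 9 × ZMod 9 → Finset (Fin n),
    (∀ q, IsLargestFeasiblePart β x ⌈4 * c * β⌉₊ (sparsified L P α β c o x q) (sol q)) ∧
    (∃ q, A = sol q) ∧ ∀ q, (sol q).card ≤ A.card

end Algorithm

section Random

variable {n : ℕ} {Ω : Type*} [MeasurableSpace Ω]

/-- The random received powers `X j i` follow the shadowing model with distribution `D`: they are
independent, and each has the law of `D` whose mean is its value under geometric path-loss. -/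
structure IsShadowing (D : SSDistribution) (L : LinkSet n) (P α : ℝ) (μ : Measure Ω)
    (X : Fin n → Fin n → Ω → ℝ) : Prop where
  measurable : ∀ j i, Measurable (X j i)
  indep : iIndepFun (fun q : Fin n × Fin n => X q.1 q.2) μ
  law : ∀ j i, μ.map (X j i) = D.law (L.gain P α j i)

/-- `ALG` is a random set that is almost surely an output of the algorithm on the random powers. -/
structure IsRun (L : LinkSet n) (P α β c : ℝ) (o : Plane) (μ : Measure Ω)
    (X : Fin n → Fin n → Ω → ℝ) (ALG : Ω → Finset (Fin n)) : Prop where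
  measurable : ∀ A, MeasurableSet {ω | ALG ω = A}
  output : ∀ᵐ ω ∂μ, IsOutput L P α β c o (fun j i => X j i ω) (ALG ω)

end Random

end

/-! The upper bound holds with factor 1, because every output is feasible. For the lower bound, the
optimum is at most the sum of the optima of the clusters, and each of these is compared in
expectation with what the greedy rule selects there.

Let `s` be the path-loss strength at the minimum length of a cluster `C`. All gains inside `C` are
at least a constant times `s`, so by smoothness each interference is of order at least `s` with
probability at least `p`. A set of `k` links has `k (k - 1)` independent interferences, so a
Chernoff bound makes "few strong interferences" have probability `exp (-p k (k - 1) / 4)`. This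
quadratic exponent beats the union bound over subsets once `k` is a multiple of `log |C|`. Any other
feasible set of that size has a constant fraction of links of strength of order `k s`, from which
the greedy rule takes order `k` (`mul_card_le_of_isFeasible`). Hence the optimum is at most a
constant times the selection, plus a term of order `log |C|` (`integral_optOn_le`). Growth of `g`
pays for the logarithm: in expectation at least `T = κ / 2 * log |C|` links exceed `T` times their
mean (`log_card_le`).

Next, the selected links must have bounded affectance. The selection depends on signal strengths
only and is independent of the interferences, so these may be replaced by their means
(`integral_sum_affectance_le`). If a cluster has `K` selected links, its good ones have strength at
least `η K s`; thus one sender affects a whole cluster by a constant times the path loss to its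
square, whatever `K` is, and the sum over squares converges because `α > 2` (`sum_gain_div_le`). A
selected link can fail to be good only when it is alone in its cluster. Each cluster loses at most
one link in this way and has at least `p` good links in expectation. Markov's inequality at level `2
c` then keeps half of the good links in expectation.

Finally, a set with affectance below `2 c` splits into `⌈4 c β⌉` feasible sets. Affectance is not
symmetric; scaling by a stationary vector makes total in- and out-weights equal, after which a
colouring of minimum monochromatic weight works (`exists_coloring`). -/

/-! ### Colouring weighted digraphs and partitioning into feasible sets -/

/-- A positive matrix with constant row sums `W` has a positive left eigenvector for `W`. -/
theorem exists_pos_left_eigenvector {ι : Type*} [Fintype ι] [Nonempty ι]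
    (M : ι → ι → ℝ) (hM : ∀ i j, 0 < M i j) {W : ℝ} (hW : ∀ i, ∑ j, M i j = W) :
    ∃ u : ι → ℝ, (∀ i, 0 < u i) ∧ ∀ j, ∑ i, u i * M i j = W * u j := by
  classical
  have hW0 : 0 < W := by
    obtain ⟨i⟩ := ‹Nonempty ι›
    rw [← hW i]
    exact Finset.sum_pos (fun j _ => hM i j) ⟨i, Finset.mem_univ i⟩
  -- The all-ones vector is a right eigenvector, so `M - W` is singular and also has a left null
  -- vector, of unknown signs.
  have hker : ∃ v : ι → ℝ, v ≠ 0 ∧ Matrix.mulVec (Matrix.of M - W • (1 : Matrix ι ι ℝ)) v = 0 := by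
    refine ⟨fun _ => 1, fun h => one_ne_zero (congrFun h (Classical.arbitrary ι)), ?_⟩
    ext i
    simp [Matrix.mulVec, dotProduct, hW, Matrix.one_apply]
  obtain ⟨v, hv0, hv⟩ := Matrix.exists_vecMul_eq_zero_iff.2 (Matrix.exists_mulVec_eq_zero_iff.1 hker)
  have hv' : ∀ j, ∑ i, v i * M i j = W * v j := by
    intro j
    have := congrFun hv j
    simp only [Matrix.vecMul_sub, Matrix.vecMul_smul, Matrix.vecMul_one, Pi.sub_apply,
      Pi.smul_apply, Pi.zero_apply, smul_eq_mul, sub_eq_zero] at this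
    simpa [Matrix.vecMul, dotProduct] using this
  -- The triangle inequality gives one direction for `|v|`. Summed over `j` both sides agree, since
  -- rows sum to `W`, so equality holds for every `j`.
  have hle : ∀ j ∈ Finset.univ, W * |v j| ≤ ∑ i, |v i| * M i j := by
    intro j _
    calc W * |v j| = |∑ i, v i * M i j| := by rw [hv', abs_mul, abs_of_pos hW0]
      _ ≤ ∑ i, |v i * M i j| := Finset.abs_sum_le_sum_abs _ _
      _ = ∑ i, |v i| * M i j := by simp [abs_mul, abs_of_pos (hM _ _)]
  have hsum : ∑ j, W * |v j| = ∑ j, ∑ i, |v i| * M i j := by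
    rw [Finset.sum_comm]
    simp_rw [← Finset.mul_sum, hW, ← Finset.sum_mul]
    rw [mul_comm]
  have heq := (Finset.sum_eq_sum_iff_of_le hle).1 hsum
  obtain ⟨i₀, hi₀⟩ := Function.ne_iff.1 hv0
  refine ⟨fun i => |v i|, fun j => ?_, fun j => (heq j (Finset.mem_univ j)).symm⟩
  have h1 : 0 < W * |v j| := by
    rw [heq j (Finset.mem_univ j)]
    exact Finset.sum_pos' (fun i _ => mul_nonneg (abs_nonneg _) (hM i j).le)
      ⟨i₀, Finset.mem_univ _, mul_pos (abs_pos.2 hi₀) (hM i₀ j)⟩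
  exact pos_of_mul_pos_right h1 hW0.le

/-- For symmetric weights there is a colouring with `k` colours such that each vertex has at most a
`1 / k` fraction of its weight in its own colour class. -/
theorem exists_coloring_of_symm {ι : Type*} [Fintype ι] [DecidableEq ι] (b : ι → ι → ℝ)
    (hb : ∀ i j, b i j = b j i) {k : ℕ} (hk : 0 < k) :
    ∃ f : ι → Fin k, ∀ i,
      k * ∑ j ∈ Finset.univ.erase i, (if f j = f i then b i j else 0) ≤
        ∑ j ∈ Finset.univ.erase i, b i j := by
  have : NeZero k := ⟨hk.ne'⟩
  -- At a minimiser of the monochromatic weight no single recolouring of `i` helps, so the class of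
  -- `i` carries at most the average, over the `k` colours, of the weight at `i`.
  let Φ : (ι → Fin k) → ℝ := fun f =>
    ∑ a, ∑ j ∈ Finset.univ.erase a, if f j = f a then b a j else 0
  obtain ⟨f, -, hf⟩ := Finset.exists_min_image (Finset.univ : Finset (ι → Fin k)) Φ
    Finset.univ_nonempty
  have split : ∀ (g : ι → Fin k) (i : ι),
      Φ g = 2 * (∑ j ∈ Finset.univ.erase i, if g j = g i then b i j else 0) +
        ∑ a ∈ Finset.univ.erase i, ∑ j ∈ (Finset.univ.erase a).erase i,
          if g j = g a then b a j else 0 := by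
    intro g i
    have h1 : ∀ a ∈ Finset.univ.erase i,
        (∑ j ∈ Finset.univ.erase a, if g j = g a then b a j else 0) =
          (if g a = g i then b i a else 0) +
          ∑ j ∈ (Finset.univ.erase a).erase i, if g j = g a then b a j else 0 := by
      intro a ha
      have hia : i ∈ Finset.univ.erase a := by
        simp only [Finset.mem_erase, Finset.mem_univ, and_true] at ha ⊢
        exact fun h => ha h.symm
      rw [← Finset.add_sum_erase _ _ hia, hb a i]
      simp only [eq_comm]
    simp only [Φ]
    rw [← Finset.add_sum_erase _ _ (Finset.mem_univ i), Finset.sum_congr rfl h1,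
      Finset.sum_add_distrib]
    ring
  refine ⟨f, fun i => ?_⟩
  have move : ∀ r : Fin k, (∑ j ∈ Finset.univ.erase i, if f j = f i then b i j else 0) ≤
      ∑ j ∈ Finset.univ.erase i, if f j = r then b i j else 0 := by
    intro r
    have h := hf (Function.update f i r) (Finset.mem_univ _)
    rw [split f i, split (Function.update f i r) i] at h
    have e1 : (∑ j ∈ Finset.univ.erase i,
        if Function.update f i r j = Function.update f i r i then b i j else 0) =
        ∑ j ∈ Finset.univ.erase i, if f j = r then b i j else 0 := by
      refine Finset.sum_congr rfl fun j hj => ?_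
      rw [Function.update_self, Function.update_of_ne (Finset.ne_of_mem_erase hj)]
    have e2 : (∑ a ∈ Finset.univ.erase i, ∑ j ∈ (Finset.univ.erase a).erase i,
        if Function.update f i r j = Function.update f i r a then b a j else 0) =
        ∑ a ∈ Finset.univ.erase i, ∑ j ∈ (Finset.univ.erase a).erase i,
          if f j = f a then b a j else 0 := by
      refine Finset.sum_congr rfl fun a ha => Finset.sum_congr rfl fun j hj => ?_
      rw [Function.update_of_ne (Finset.ne_of_mem_erase hj),
        Function.update_of_ne (Finset.ne_of_mem_erase ha)]
    rw [e1, e2] at h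
    linarith
  calc (k : ℝ) * ∑ j ∈ Finset.univ.erase i, (if f j = f i then b i j else 0)
      = ∑ _r : Fin k, ∑ j ∈ Finset.univ.erase i, (if f j = f i then b i j else 0) := by
        rw [Finset.sum_const, Finset.card_univ, Fintype.card_fin, nsmul_eq_mul]
    _ ≤ ∑ r : Fin k, ∑ j ∈ Finset.univ.erase i, (if f j = r then b i j else 0) :=
        Finset.sum_le_sum fun r _ => move r
    _ = ∑ j ∈ Finset.univ.erase i, b i j := by
        rw [Finset.sum_comm]
        simp

/-- A weighted digraph with in-weights less than `W` can be coloured with `k` colours such that the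
in-weights within the colour classes are less than `2 * W / k`. -/
theorem exists_coloring {ι : Type*} [Fintype ι] [DecidableEq ι] (w : ι → ι → ℝ)
    {W : ℝ} (hW : ∀ i, ∑ j ∈ Finset.univ.erase i, w i j < W) (hw : ∀ i j, 0 ≤ w i j)
    {k : ℕ} (hk : 0 < k) :
    ∃ f : ι → Fin k, ∀ i,
      k * ∑ j ∈ Finset.univ.erase i, (if f j = f i then w i j else 0) < 2 * W := by
  rcases isEmpty_or_nonempty ι with hι | hι
  · exact ⟨fun i => isEmptyElim i, fun i => isEmptyElim i⟩
  let N : ℝ := Fintype.card ι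
  have hN : 0 < N := Nat.cast_pos.2 Fintype.card_pos
  -- The strict bound leaves slack: raising the off-diagonal entries of row `i` by `ε i` uses at
  -- most half of it, and a positive diagonal entry fills the row up to `W`.
  let ε : ι → ℝ := fun i => (W - ∑ j ∈ Finset.univ.erase i, w i j) / (2 * N)
  have hε : ∀ i, 0 < ε i := fun i => div_pos (sub_pos.2 (hW i)) (by positivity)
  let M : ι → ι → ℝ := fun i j =>
    if j = i then W - ∑ j ∈ Finset.univ.erase i, (w i j + ε i) else w i j + ε i
  have hdiag : ∀ i, 0 < W - ∑ j ∈ Finset.univ.erase i, (w i j + ε i) := by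
    intro i
    rw [Finset.sum_add_distrib, Finset.sum_const, nsmul_eq_mul]
    have h1 : ((Finset.univ.erase i).card : ℝ) * ε i ≤ N * ε i := by
      refine mul_le_mul_of_nonneg_right ?_ (hε i).le
      exact Nat.cast_le.2 (Finset.card_le_univ _)
    have h2 : N * ε i = (W - ∑ j ∈ Finset.univ.erase i, w i j) / 2 := by
      simp only [ε]; field_simp
    have := hW i
    linarith
  have hM : ∀ i j, 0 < M i j := by
    intro i j
    simp only [M]
    split_ifs
    · exact hdiag i
    · exact add_pos_of_nonneg_of_pos (hw i j) (hε i)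
  have hoff : ∀ i, ∑ j ∈ Finset.univ.erase i, M i j =
      ∑ j ∈ Finset.univ.erase i, (w i j + ε i) := fun i =>
    Finset.sum_congr rfl fun j hj => by simp only [M, if_neg (Finset.ne_of_mem_erase hj)]
  have hrow : ∀ i, ∑ j, M i j = W := by
    intro i
    rw [← Finset.add_sum_erase _ _ (Finset.mem_univ i), hoff]
    simp [M]
  -- With the scaling by `u`, row `i` and column `i` both sum to `W * u i`. The symmetrised weight
  -- at `i` is then below `2 * W * u i`, although only in-weights were bounded.
  obtain ⟨u, hu, hstat⟩ := exists_pos_left_eigenvector M hM hrow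
  obtain ⟨f, hf⟩ := exists_coloring_of_symm (fun i j => u i * M i j + u j * M j i)
    (fun i j => add_comm _ _) hk
  refine ⟨f, fun i => ?_⟩
  have hk' : (0 : ℝ) < k := by exact_mod_cast hk
  have h1 : ∑ j ∈ Finset.univ.erase i, (u i * M i j + u j * M j i) < u i * (2 * W) := by
    rw [Finset.sum_add_distrib, ← Finset.mul_sum]
    have e1 := Finset.add_sum_erase _ (fun j => M i j) (Finset.mem_univ i)
    have e2 := Finset.add_sum_erase _ (fun j => u j * M j i) (Finset.mem_univ i)
    simp only [hrow, hstat] at e1 e2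
    have := mul_pos (hu i) (hM i i)
    have e3 := congrArg (u i * ·) e1
    simp only [mul_add] at e3
    linarith
  have h2 : u i * ∑ j ∈ Finset.univ.erase i, (if f j = f i then w i j else 0) ≤
      ∑ j ∈ Finset.univ.erase i, (if f j = f i then u i * M i j + u j * M j i else 0) := by
    rw [Finset.mul_sum]
    refine Finset.sum_le_sum fun j hj => ?_
    split_ifs with h
    · have : w i j ≤ M i j := by
        simp only [M, if_neg (Finset.ne_of_mem_erase hj)]
        linarith [hε i]
      have := mul_le_mul_of_nonneg_left this (hu i).le
      have := mul_pos (hu j) (hM j i)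
      linarith
    · simp
  have h3 := mul_le_mul_of_nonneg_left h2 hk'.le
  have h4 := (h3.trans (hf i)).trans_lt h1
  rw [mul_left_comm] at h4
  exact lt_of_mul_lt_mul_left h4 (hu i).le

/-- A set whose links have positive strengths and affectance less than `2 * c` can be partitioned into
`⌈4 * c * β⌉` feasible sets. -/
theorem exists_isLargestFeasiblePart {n : ℕ} {β c : ℝ} (hβ : 0 < β) (hc : 0 < c)
    {x : Fin n → Fin n → ℝ} (hx : ∀ j i, 0 ≤ x j i) {R S : Finset (Fin n)} (hRS : R ⊆ S)
    (hpos : ∀ j ∈ R, 0 < x j j) (haff : ∀ j ∈ R, affectance x S j < 2 * c) :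
    ∃ A, IsLargestFeasiblePart β x ⌈4 * c * β⌉₊ R A := by
  classical
  have hk : 0 < ⌈4 * c * β⌉₊ := Nat.ceil_pos.2 (by positivity)
  set k := ⌈4 * c * β⌉₊ with hkdef
  have hk4 : 4 * c * β ≤ k := Nat.le_ceil _
  obtain ⟨f, hf⟩ := exists_coloring
    (fun i j => if i ∈ R ∧ j ∈ R then x j i / x i i else 0) (W := 2 * c)
    (fun i => by
      by_cases hi : i ∈ R
      · refine lt_of_le_of_lt ?_ (haff i hi)
        rw [affectance, ← Finset.sum_filter]
        refine Finset.sum_le_sum_of_subset_of_nonneg (fun j hj => ?_)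
          (fun j _ _ => div_nonneg (hx _ _) (hx _ _))
        simp only [Finset.mem_filter, Finset.mem_erase, Finset.mem_univ, and_true] at hj
        exact Finset.mem_erase.2 ⟨hj.1, hRS hj.2.2⟩
      · simp [hi, hc])
    (fun i j => by
      split_ifs
      · exact div_nonneg (hx _ _) (hx _ _)
      · exact le_rfl) hk
  let part : Fin k → Finset (Fin n) := fun r => R.filter fun i => f i = r
  have : Nonempty (Fin k) := ⟨⟨0, hk⟩⟩
  obtain ⟨r₀, hr₀⟩ := Finite.exists_max fun r => (part r).card
  refine ⟨part r₀, part, fun r r' hrr => ?_, ?_, fun r i hi => ?_, ⟨r₀, rfl⟩, hr₀⟩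
  · refine Finset.disjoint_filter.2 fun i _ h1 h2 => hrr (h1.symm.trans h2)
  · ext i
    simp [part]
  · obtain ⟨hiR, rfl⟩ := Finset.mem_filter.1 hi
    have hsum : ∑ j ∈ (part (f i)).erase i, x j i = x i i * ∑ j ∈ Finset.univ.erase i,
        (if f j = f i then (if i ∈ R ∧ j ∈ R then x j i / x i i else 0) else 0) := by
      rw [Finset.mul_sum]
      have hsub : (part (f i)).erase i ⊆ Finset.univ.erase i :=
        Finset.erase_subset_erase _ (Finset.subset_univ _)
      rw [← Finset.sum_subset hsub]
      · refine Finset.sum_congr rfl fun j hj => ?_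
        obtain ⟨hjR, hj⟩ := Finset.mem_filter.1 (Finset.mem_of_mem_erase hj)
        rw [if_pos hj, if_pos ⟨hiR, hjR⟩, mul_div_cancel₀ _ (hpos i hiR).ne']
      · intro j hj hj'
        by_cases h1 : f j = f i
        · by_cases h2 : j ∈ R
          · exact absurd (Finset.mem_erase.2 ⟨Finset.ne_of_mem_erase hj,
              Finset.mem_filter.2 ⟨h2, h1⟩⟩) hj'
          · simp [h2]
        · simp [h1]
    rw [hsum]
    have h1 := hf i
    set σ := ∑ j ∈ Finset.univ.erase i,
        (if f j = f i then (if i ∈ R ∧ j ∈ R then x j i / x i i else 0) else 0)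
    have hσ : 0 ≤ σ := Finset.sum_nonneg fun j _ => by
      split_ifs
      · exact div_nonneg (hx _ _) (hx _ _)
      · exact le_rfl
      · exact le_rfl
    -- Here `σ` is the affectance on `i` from its own class; the number of colours is chosen so that
    -- it falls below `1 / β`.
    have h2 : 4 * c * β * σ < 2 * (2 * c) :=
      (mul_le_mul_of_nonneg_right hk4 hσ).trans_lt h1
    have h3 : β * σ < 1 := by
      have h4 : (4 * c) * (β * σ) < (4 * c) * 1 := by linarith
      exact lt_of_mul_lt_mul_left h4 (by positivity)
    calc β * (x i i * σ) = x i i * (β * σ) := by ring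
      _ < x i i * 1 := mul_lt_mul_of_pos_left h3 (hpos i hiR)
      _ = x i i := mul_one _

/-- A largest class has at least the average size. -/
theorem IsLargestFeasiblePart.card_le {n : ℕ} {β : ℝ} {x : Fin n → Fin n → ℝ} {k : ℕ}
    {R A : Finset (Fin n)} (h : IsLargestFeasiblePart β x k R A) : R.card ≤ k * A.card := by
  classical
  obtain ⟨part, -, rfl, -, -, hmax⟩ := h
  refine (Finset.card_biUnion_le_card_mul _ _ _ fun r _ => hmax r).trans ?_
  simp

theorem IsLargestFeasiblePart.isFeasible {n : ℕ} {β : ℝ} {x : Fin n → Fin n → ℝ} {k : ℕ}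
    {R A : Finset (Fin n)} (h : IsLargestFeasiblePart β x k R A) : IsFeasible β x A := by
  obtain ⟨part, -, -, hf, ⟨r, rfl⟩, -⟩ := h
  exact hf r

/-! ### The greedy rule on a sorted list -/

/-- Step of the cluster algorithm: link `i` is added if its strength exceeds `θ` times the number of
links already selected. -/
noncomputable def greedyStep {ι : Type*} [DecidableEq ι] (θ : ℝ) (y : ι → ℝ) (S : Finset ι) (i : ι) : Finset ι :=
  open Classical in if θ * S.card < y i then insert i S else S

section Greedy

variable {ι : Type*} [DecidableEq ι] {θ : ℝ} {y : ι → ℝ}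

theorem subset_greedyStep (S : Finset ι) (i : ι) : S ⊆ greedyStep θ y S i := by
  unfold greedyStep
  split_ifs
  · exact Finset.subset_insert _ _
  · exact Finset.Subset.refl _

theorem subset_foldl_greedyStep (l : List ι) (S : Finset ι) :
    S ⊆ l.foldl (greedyStep θ y) S := by
  induction l generalizing S with
  | nil => exact Finset.Subset.refl _
  | cons a l ih => exact (subset_greedyStep S a).trans (ih _)

theorem mem_or_of_mem_foldl_greedyStep (l : List ι) (S : Finset ι) {j : ι}
    (hj : j ∈ l.foldl (greedyStep θ y) S) : j ∈ S ∨ j ∈ l := by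
  induction l generalizing S with
  | nil => exact Or.inl hj
  | cons a l ih =>
    rcases ih _ hj with h | h
    · unfold greedyStep at h
      split_ifs at h
      · rcases Finset.mem_insert.1 h with rfl | h
        · simp
        · exact Or.inl h
      · exact Or.inl h
    · exact Or.inr (List.mem_cons_of_mem _ h)

/-- The selected set only grows, so a link that beats the threshold of the final size also beats the
one in force at its turn. The order of the list plays no role. -/
theorem mem_foldl_greedyStep_of_lt (hθ : 0 ≤ θ) (l : List ι) (S : Finset ι) {i : ι} (hi : i ∈ l)
    (h : θ * ((l.foldl (greedyStep θ y) S).card : ℝ) < y i) :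
    i ∈ l.foldl (greedyStep θ y) S := by
  induction l generalizing S with
  | nil => simp at hi
  | cons a l ih =>
    rcases List.mem_cons.1 hi with rfl | hi
    · refine subset_foldl_greedyStep l _ ?_
      have hle : θ * (S.card : ℝ) ≤ θ * (((i :: l).foldl (greedyStep θ y) S).card : ℝ) :=
        mul_le_mul_of_nonneg_left
          (Nat.cast_le.2 (Finset.card_le_card (subset_foldl_greedyStep _ _))) hθ
      rw [greedyStep, if_pos (hle.trans_lt h)]
      exact Finset.mem_insert_self _ _
    · exact ih _ hi h

/-- The last link added had to pass the threshold for the final size minus one, and in decreasing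
order every earlier addition is at least as strong. -/
theorem lt_of_mem_foldl_greedyStep (l : List ι) (hl : l.Pairwise fun i j => y j ≤ y i)
    (S : Finset ι) {j : ι} (hj : j ∈ l.foldl (greedyStep θ y) S) (hjS : j ∉ S) (hθ : 0 ≤ θ) :
    θ * (((l.foldl (greedyStep θ y) S).card : ℝ) - 1) < y j := by
  induction l generalizing S j with
  | nil => exact absurd hj hjS
  | cons a l ih =>
    rw [List.pairwise_cons] at hl
    obtain ⟨ha, hl⟩ := hl
    rw [List.foldl_cons] at hj ⊢
    by_cases hadd : θ * S.card < y a
    · have hstep : greedyStep θ y S a = insert a S := if_pos hadd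
      rw [hstep] at hj ⊢
      by_cases hja : j = a
      · subst hja
        by_cases hsub : l.foldl (greedyStep θ y) (insert j S) ⊆ insert j S
        · have hcard : ((l.foldl (greedyStep θ y) (insert j S)).card : ℝ) - 1 ≤ S.card := by
            have := (Finset.card_le_card hsub).trans (Finset.card_insert_le j S)
            have : ((l.foldl (greedyStep θ y) (insert j S)).card : ℝ) ≤ S.card + 1 := by
              exact_mod_cast this
            linarith
          exact (mul_le_mul_of_nonneg_left hcard hθ).trans_lt hadd
        · obtain ⟨b, hb, hbS⟩ := Finset.not_subset.1 hsub
          have hbl := (mem_or_of_mem_foldl_greedyStep _ _ hb).resolve_left hbS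
          exact (ih hl _ hb hbS).trans_le (ha b hbl)
      · exact ih hl _ hj (by simp [hja, hjS])
    · have hstep : greedyStep θ y S a = S := if_neg hadd
      rw [hstep] at hj ⊢
      exact ih hl _ hj hjS

/-- A link rejected at size `|S|` has strength at most `θ * |S|`. If some link is selected later,
the final size is at least `|S| + 1`, and that link exceeds `θ` times the final size minus one. -/
theorem le_of_notMem_foldl_greedyStep (l : List ι) (hl : l.Pairwise fun i j => y j ≤ y i)
    (S : Finset ι) {i j : ι} (hj : j ∈ l.foldl (greedyStep θ y) S) (hjS : j ∉ S) (hθ : 0 ≤ θ)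
    (hi : i ∈ l) (hi' : i ∉ l.foldl (greedyStep θ y) S) : y i ≤ y j := by
  induction l generalizing S with
  | nil => simp at hi
  | cons a l ih =>
    have hl0 := hl
    obtain ⟨ha, hl⟩ := List.pairwise_cons.1 hl
    by_cases hadd : θ * S.card < y a
    · have hstep : greedyStep θ y S a = insert a S := if_pos hadd
      rw [List.foldl_cons, hstep] at hj hi'
      have hia : i ≠ a := fun h =>
        hi' (subset_foldl_greedyStep _ _ (h ▸ Finset.mem_insert_self _ _))
      have hil := (List.mem_cons.1 hi).resolve_left hia
      by_cases hja : j = a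
      · exact hja ▸ ha i hil
      · exact ih hl _ hj (by simp [hja, hjS]) hil hi'
    · have hlt := lt_of_mem_foldl_greedyStep _ hl0 S hj hjS hθ
      have hstep : greedyStep θ y S a = S := if_neg hadd
      rcases List.mem_cons.1 hi with rfl | hil
      · have hcard : S.card + 1 ≤ ((i :: l).foldl (greedyStep θ y) S).card := by
          rw [← Finset.card_insert_of_notMem hjS]
          exact Finset.card_le_card (Finset.insert_subset hj (subset_foldl_greedyStep _ _))
        have hcard' : (S.card : ℝ) ≤ ((i :: l).foldl (greedyStep θ y) S).card - 1 := by
          have : ((S.card : ℝ) + 1) ≤ ((i :: l).foldl (greedyStep θ y) S).card := by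
            exact_mod_cast hcard
          linarith
        have := mul_le_mul_of_nonneg_left hcard' hθ
        linarith
      · rw [List.foldl_cons, hstep] at hj hi'
        exact ih hl _ hj hjS hil hi'

end Greedy

/-! ### Selected and good links of one cluster -/

section ClusterSelect

variable {n : ℕ} {L : LinkSet n} {P α β : ℝ} {x : Fin n → Fin n → ℝ} {C : Finset (Fin n)}

theorem mem_byStrength {i : Fin n} : i ∈ byStrength x C ↔ i ∈ C := by
  simp [byStrength, List.mem_insertionSort]

theorem pairwise_byStrength : (byStrength x C).Pairwise fun i j => x j j ≤ x i i := by
  classical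
  have : Std.Total fun i j : Fin n => x j j ≤ x i i := ⟨fun i j => le_total _ _⟩
  have : IsTrans (Fin n) fun i j => x j j ≤ x i i := ⟨fun i j k h1 h2 => h2.trans h1⟩
  exact List.pairwise_insertionSort _ _

theorem clusterSelect_eq_foldl : clusterSelect L P α β x C =
    (byStrength x C).foldl (greedyStep (2 * β * (P / L.minLen C ^ α)) fun i => x i i) ∅ := by
  unfold clusterSelect
  congr 1
  funext S i
  simp only [greedyStep]
  rw [mul_right_comm]

theorem LinkSet.minLen_nonneg (T : Finset (Fin n)) : 0 ≤ L.minLen T :=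
  Real.sInf_nonneg (by rintro _ ⟨i, -, rfl⟩; exact dist_nonneg)

theorem threshold_nonneg (hβ : 0 ≤ β) (hP : 0 ≤ P) : 0 ≤ 2 * β * (P / L.minLen C ^ α) :=
  mul_nonneg (by positivity) (div_nonneg hP (Real.rpow_nonneg (LinkSet.minLen_nonneg C) _))

theorem clusterSelect_subset : clusterSelect L P α β x C ⊆ C := by
  intro i hi
  rw [clusterSelect_eq_foldl] at hi
  exact mem_byStrength.1 ((mem_or_of_mem_foldl_greedyStep _ _ hi).resolve_left (by simp))

/-- If fewer than `r` links were selected, each of the `r` links above the threshold for size `r -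
1` would have been accepted. Lower bounds on the greedy size come from here. -/
theorem le_card_clusterSelect (hβ : 0 ≤ β) (hP : 0 ≤ P) {r : ℕ}
    (hr : r ≤ (C.filter fun i => 2 * β * (P / L.minLen C ^ α) * ((r : ℝ) - 1) < x i i).card) :
    r ≤ (clusterSelect L P α β x C).card := by
  by_contra! hlt
  have hsub : (C.filter fun i => 2 * β * (P / L.minLen C ^ α) * ((r : ℝ) - 1) < x i i) ⊆
      clusterSelect L P α β x C := by
    intro i hi
    obtain ⟨hiC, hi⟩ := Finset.mem_filter.1 hi
    have hcard : ((clusterSelect L P α β x C).card : ℝ) ≤ (r : ℝ) - 1 := by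
      have : ((clusterSelect L P α β x C).card : ℝ) + 1 ≤ r := by exact_mod_cast hlt
      linarith
    rw [clusterSelect_eq_foldl] at hcard ⊢
    exact mem_foldl_greedyStep_of_lt (threshold_nonneg hβ hP) _ _ (mem_byStrength.2 hiC)
      ((mul_le_mul_of_nonneg_left hcard (threshold_nonneg hβ hP)).trans_lt hi)
  exact absurd (hr.trans (Finset.card_le_card hsub)) (not_le.2 hlt)

theorem lt_of_mem_clusterSelect (hβ : 0 ≤ β) (hP : 0 ≤ P) {j : Fin n}
    (hj : j ∈ clusterSelect L P α β x C) :
    2 * β * (P / L.minLen C ^ α) * (((clusterSelect L P α β x C).card : ℝ) - 1) < x j j := by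
  rw [clusterSelect_eq_foldl] at hj ⊢
  exact lt_of_mem_foldl_greedyStep (y := fun i => x i i) _ pairwise_byStrength _ hj (by simp)
    (threshold_nonneg hβ hP)

theorem pos_of_mem_clusterSelect (hβ : 0 ≤ β) (hP : 0 ≤ P) {j : Fin n}
    (hj : j ∈ clusterSelect L P α β x C) : 0 < x j j := by
  refine lt_of_le_of_lt (mul_nonneg (threshold_nonneg hβ hP) ?_) (lt_of_mem_clusterSelect hβ hP hj)
  rw [sub_nonneg]
  exact_mod_cast Finset.card_pos.2 ⟨j, hj⟩

theorem le_of_notMem_clusterSelect (hβ : 0 ≤ β) (hP : 0 ≤ P) {i j : Fin n} (hi : i ∈ C)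
    (hj : j ∈ clusterSelect L P α β x C) (hi' : i ∉ clusterSelect L P α β x C) :
    x i i ≤ x j j := by
  rw [clusterSelect_eq_foldl] at hj hi'
  exact le_of_notMem_foldl_greedyStep (y := fun i => x i i) _ pairwise_byStrength _ hj (by simp)
    (threshold_nonneg hβ hP) (mem_byStrength.2 hi) hi'

theorem clusterSelect_nonempty (hβ : 0 ≤ β) (hP : 0 ≤ P) {i : Fin n} (hi : i ∈ C)
    (hpos : 0 < x i i) : (clusterSelect L P α β x C).Nonempty := by
  rw [← Finset.card_pos]
  refine Nat.succ_le_iff.1 (le_card_clusterSelect hβ hP (r := 1) ?_)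
  exact Finset.card_pos.2 ⟨i, Finset.mem_filter.2 ⟨hi, by simpa using hpos⟩⟩

/-- The links selected in a cluster whose strength is at least a constant fraction of the number of
selected links times the strength of a link of minimum length under geometric path-loss. -/
noncomputable def goodSelect (L : LinkSet n) (P α β η : ℝ) (x : Fin n → Fin n → ℝ) (C : Finset (Fin n)) :
    Finset (Fin n) :=
  open Classical in (clusterSelect L P α β x C).filter fun j =>
    η * ((clusterSelect L P α β x C).card : ℝ) * (P / L.minLen C ^ α) ≤ x j j

/-- For `K ≥ 2` selected links, `K - 1 ≥ K / 2` turns the threshold `2 * β * (K - 1)` into `β * K`.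
A lone selected link only had to beat zero, so it alone may fail to be good. -/
theorem goodSelect_eq {η : ℝ} (hβ : 0 ≤ β) (hP : 0 ≤ P) (hη : η ≤ β)
    (hcard : 2 ≤ (clusterSelect L P α β x C).card) :
    goodSelect L P α β η x C = clusterSelect L P α β x C := by
  classical
  refine Finset.filter_true_of_mem fun j hj => ?_
  have h1 := lt_of_mem_clusterSelect hβ hP hj
  have h2 : (2 : ℝ) ≤ (clusterSelect L P α β x C).card := by exact_mod_cast hcard
  set K := ((clusterSelect L P α β x C).card : ℝ)
  have hs : 0 ≤ P / L.minLen C ^ α :=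
    div_nonneg hP (Real.rpow_nonneg (LinkSet.minLen_nonneg C) _)
  set s := P / L.minLen C ^ α
  have h3 : η * K ≤ 2 * β * (K - 1) := by nlinarith
  have h4 := mul_le_mul_of_nonneg_right h3 hs
  nlinarith

theorem card_clusterSelect_le {η : ℝ} (hβ : 0 ≤ β) (hP : 0 ≤ P) (hη : η ≤ β) :
    (clusterSelect L P α β x C).card ≤ (goodSelect L P α β η x C).card + 1 := by
  by_cases h : 2 ≤ (clusterSelect L P α β x C).card
  · rw [goodSelect_eq hβ hP hη h]
    omega
  · omega

/-- The critical case is a lone selected link: it is a strongest link of the cluster, hence at least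
as strong as `i`. -/
theorem goodSelect_nonempty {η : ℝ} (hβ : 0 ≤ β) (hP : 0 ≤ P) (hη : η ≤ β) {i : Fin n}
    (hi : i ∈ C) (hpos : 0 < x i i) (hgood : η * (P / L.minLen C ^ α) ≤ x i i) :
    (goodSelect L P α β η x C).Nonempty := by
  classical
  obtain ⟨j, hj⟩ := clusterSelect_nonempty (L := L) (α := α) hβ hP hi hpos
  by_cases h : 2 ≤ (clusterSelect L P α β x C).card
  · rw [goodSelect_eq hβ hP hη h]
    exact ⟨j, hj⟩
  · have h1 : (clusterSelect L P α β x C).card = 1 := by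
      have := Finset.card_pos.2 ⟨j, hj⟩
      omega
    refine ⟨j, Finset.mem_filter.2 ⟨hj, ?_⟩⟩
    rw [h1, Nat.cast_one, mul_one]
    refine hgood.trans ?_
    by_cases hi' : i ∈ clusterSelect L P α β x C
    · obtain ⟨a, ha⟩ := Finset.card_eq_one.1 h1
      rw [ha, Finset.mem_singleton] at hi' hj
      rw [hi', hj]
    · exact le_of_notMem_clusterSelect hβ hP hi hj hi'

end ClusterSelect

/-! ### Geometry of the grid -/

namespace LinkSet

variable {n : ℕ} {L : LinkSet n}

theorem minLen_le {T : Finset (Fin n)} {i : Fin n} (hi : i ∈ T) : L.minLen T ≤ L.len i :=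
  csInf_le ⟨0, by rintro _ ⟨i, -, rfl⟩; exact dist_nonneg⟩ ⟨i, hi, rfl⟩

theorem exists_minLen_eq {T : Finset (Fin n)} (hT : T.Nonempty) : ∃ i ∈ T, L.minLen T = L.len i := by
  obtain ⟨i, hi, h⟩ := (hT.to_set.image L.len).csInf_mem (T.finite_toSet.image _)
  exact ⟨i, hi, h.symm⟩

theorem minLen_anti {T T' : Finset (Fin n)} (h : T ⊆ T') (hT : T.Nonempty) :
    L.minLen T' ≤ L.minLen T := by
  obtain ⟨i, hi, h'⟩ := exists_minLen_eq (L := L) hT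
  exact h' ▸ minLen_le (h hi)

theorem minLen_pos (hL : ∀ j i, L.sender j ≠ L.receiver i) {T : Finset (Fin n)}
    (hT : T.Nonempty) : 0 < L.minLen T := by
  obtain ⟨i, hi, h⟩ := exists_minLen_eq (L := L) hT
  rw [h]
  exact dist_pos.2 (hL i i)

theorem Equilength.len_lt {T : Finset (Fin n)} (h : L.Equilength T) {i : Fin n} (hi : i ∈ T) :
    L.len i < 2 * L.minLen T := by
  obtain ⟨j, hj, h'⟩ := exists_minLen_eq (L := L) ⟨i, hi⟩
  exact h' ▸ h i hi j hj

theorem Equilength.mono {T T' : Finset (Fin n)} (h : L.Equilength T') (hT : T ⊆ T') :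
    L.Equilength T := fun i hi j hj => h i (hT hi) j (hT hj)

variable {o : Plane} {q : ZMod 9 × ZMod 9}

theorem mem_clusters {C : Finset (Fin n)} : C ∈ L.clusters o q ↔
    ∃ i ∈ L.gridClass o q, {j ∈ L.gridClass o q | L.square o j = L.square o i} = C := by
  simp [clusters]

theorem subset_gridClass_of_mem_clusters {C : Finset (Fin n)} (hC : C ∈ L.clusters o q) :
    C ⊆ L.gridClass o q := by
  obtain ⟨i, -, rfl⟩ := mem_clusters.1 hC
  exact Finset.filter_subset _ _

theorem nonempty_of_mem_clusters {C : Finset (Fin n)} (hC : C ∈ L.clusters o q) : C.Nonempty := by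
  obtain ⟨i, hi, rfl⟩ := mem_clusters.1 hC
  exact ⟨i, Finset.mem_filter.2 ⟨hi, rfl⟩⟩

theorem square_eq_of_mem_clusters {C : Finset (Fin n)} (hC : C ∈ L.clusters o q) {i j : Fin n}
    (hi : i ∈ C) (hj : j ∈ C) : L.square o i = L.square o j := by
  obtain ⟨k, hk, rfl⟩ := mem_clusters.1 hC
  exact (Finset.mem_filter.1 hi).2.trans (Finset.mem_filter.1 hj).2.symm

theorem eq_of_square_eq {C C' : Finset (Fin n)} (hC : C ∈ L.clusters o q)
    (hC' : C' ∈ L.clusters o q) {i j : Fin n} (hi : i ∈ C) (hj : j ∈ C')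
    (h : L.square o i = L.square o j) : C = C' := by
  obtain ⟨k, hk, rfl⟩ := mem_clusters.1 hC
  obtain ⟨k', hk', rfl⟩ := mem_clusters.1 hC'
  rw [← (Finset.mem_filter.1 hi).2, ← (Finset.mem_filter.1 hj).2, h]

theorem biUnion_clusters : (L.clusters o q).biUnion id = L.gridClass o q := by
  ext i
  simp only [Finset.mem_biUnion, id]
  constructor
  · rintro ⟨C, hC, hi⟩
    exact subset_gridClass_of_mem_clusters hC hi
  · intro hi
    exact ⟨_, mem_clusters.2 ⟨i, hi, rfl⟩, Finset.mem_filter.2 ⟨hi, rfl⟩⟩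

theorem disjoint_clusters {C C' : Finset (Fin n)} (hC : C ∈ L.clusters o q)
    (hC' : C' ∈ L.clusters o q) (h : C ≠ C') : Disjoint C C' :=
  Finset.disjoint_left.2 fun _ hi hi' => h (eq_of_square_eq hC hC' hi hi' rfl)

theorem abs_sub_le_dist (a b : Plane) (k : Fin 2) : |a k - b k| ≤ dist a b := by
  rw [dist_eq_norm]
  exact PiLp.norm_apply_le (a - b) k

theorem abs_floor_sub_floor_le (a b : ℝ) : |((⌊a⌋ - ⌊b⌋ : ℤ) : ℝ)| - 1 ≤ |a - b| := by
  have h1 := Int.floor_le a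
  have h2 := Int.lt_floor_add_one a
  have h3 := Int.floor_le b
  have h4 := Int.lt_floor_add_one b
  push_cast
  have h5 := le_abs_self (a - b)
  have h6 := neg_abs_le (a - b)
  have : |(⌊a⌋ : ℝ) - ⌊b⌋| ≤ |a - b| + 1 := abs_le.2 ⟨by linarith, by linarith⟩
  linarith

theorem abs_floor_sub_floor_mul_le {a b h : ℝ} (hh : 0 < h) (c : ℝ) :
    (|((⌊(a - c) / h⌋ - ⌊(b - c) / h⌋ : ℤ) : ℝ)| - 1) * h ≤ |a - b| := by
  have h1 := mul_le_mul_of_nonneg_right (abs_floor_sub_floor_le ((a - c) / h) ((b - c) / h)) hh.le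
  have h2 : |(a - c) / h - (b - c) / h| * h = |a - b| := by
    rw [← sub_div, sub_sub_sub_cancel_right, abs_div, abs_of_pos hh, div_mul_cancel₀ _ hh.ne']
  rwa [h2] at h1

theorem abs_sub_lt_of_floor_eq {a b h : ℝ} (hh : 0 < h) {c : ℝ}
    (he : ⌊(a - c) / h⌋ = ⌊(b - c) / h⌋) : |a - b| < h := by
  have h1 := Int.abs_sub_lt_one_of_floor_eq_floor he
  rwa [← sub_div, sub_sub_sub_cancel_right, abs_div, abs_of_pos hh, div_lt_one hh] at h1

/-- The constant `3 / 4` is a rational bound for `√2 / 2`, the diagonal of a square relative to the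
minimum length. Being below 1, it keeps senders away from the receivers of links with senders in the
same square. -/
theorem dist_sender_le (hL : ∀ j i, L.sender j ≠ L.receiver i) {i j : Fin n}
    (h : L.square o i = L.square o j) :
    dist (L.sender i) (L.sender j) ≤ 3 / 4 * L.minLen Finset.univ := by
  have hl : 0 < L.minLen Finset.univ := minLen_pos hL ⟨i, Finset.mem_univ i⟩
  have h0 := abs_sub_lt_of_floor_eq (half_pos hl) (congrArg Prod.fst h)
  have h1 := abs_sub_lt_of_floor_eq (half_pos hl) (congrArg Prod.snd h)
  rw [EuclideanSpace.dist_eq, Fin.sum_univ_two, Real.dist_eq, Real.dist_eq]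
  refine Real.sqrt_le_iff.2 ⟨by positivity, ?_⟩
  have h0' := mul_self_le_mul_self (abs_nonneg _) h0.le
  have h1' := mul_self_le_mul_self (abs_nonneg _) h1.le
  nlinarith

/-- In a class of the grid, the distance of a sender and a receiver is bounded from below in terms of
the coordinates of their squares. -/
theorem le_dist_sender_receiver (hL : ∀ j i, L.sender j ≠ L.receiver i)
    (hE : L.Equilength Finset.univ) {i j : Fin n} (hi : i ∈ L.gridClass o q)
    (hj : j ∈ L.gridClass o q) :
    (1 + |(((L.square o i).1 - (L.square o j).1 : ℤ) : ℝ)|) * (L.minLen Finset.univ / 8) ≤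
        dist (L.sender i) (L.receiver j) ∧
      (1 + |(((L.square o i).2 - (L.square o j).2 : ℤ) : ℝ)|) * (L.minLen Finset.univ / 8) ≤
        dist (L.sender i) (L.receiver j) ∧
      (L.square o i ≠ L.square o j →
        2 * L.minLen Finset.univ < dist (L.sender i) (L.receiver j)) := by
  have hl : 0 < L.minLen Finset.univ := minLen_pos hL ⟨i, Finset.mem_univ i⟩
  have hlen : L.len j < 2 * L.minLen Finset.univ := hE.len_lt (Finset.mem_univ j)
  have hlen' : L.minLen Finset.univ ≤ L.len j := minLen_le (Finset.mem_univ j)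
  have tri : dist (L.sender i) (L.sender j) ≤ dist (L.sender i) (L.receiver j) + L.len j := by
    have := dist_triangle (L.sender i) (L.receiver j) (L.sender j)
    rwa [dist_comm (L.receiver j)] at this
  have tri' : L.len j ≤ dist (L.sender i) (L.sender j) + dist (L.sender i) (L.receiver j) := by
    have := dist_triangle (L.sender j) (L.sender i) (L.receiver j)
    rwa [dist_comm (L.sender j) (L.sender i)] at this
  have g1 : (|(((L.square o i).1 - (L.square o j).1 : ℤ) : ℝ)| - 1) * (L.minLen Finset.univ / 2) ≤
      dist (L.sender i) (L.sender j) :=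
    (abs_floor_sub_floor_mul_le (half_pos hl) (o 0)).trans (abs_sub_le_dist _ _ 0)
  have g2 : (|(((L.square o i).2 - (L.square o j).2 : ℤ) : ℝ)| - 1) * (L.minLen Finset.univ / 2) ≤
      dist (L.sender i) (L.sender j) :=
    (abs_floor_sub_floor_mul_le (half_pos hl) (o 1)).trans (abs_sub_le_dist _ _ 1)
  have hij := (Finset.mem_filter.1 hi).2.trans (Finset.mem_filter.1 hj).2.symm
  -- Coordinates that are congruent but different put the senders at least `(9 - 1) / 2 = 4` minimum
  -- lengths apart. A receiver is less than 2 from its own sender, which leaves more than 2.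
  have nine : ∀ a b : ℤ, (a : ZMod 9) = b → a ≠ b → (9 : ℝ) ≤ |((a - b : ℤ) : ℝ)| := by
    intro a b hab hne
    have hdvd : (9 : ℤ) ∣ a - b := by
      have := (ZMod.intCast_eq_intCast_iff_dvd_sub b a 9).1 hab.symm
      exact_mod_cast this
    have := Int.le_of_dvd (abs_pos.2 (sub_ne_zero.2 hne)) ((dvd_abs _ _).2 hdvd)
    exact_mod_cast this
  have e1 := nine _ _ (congrArg Prod.fst hij)
  have e2 := nine _ _ (congrArg Prod.snd hij)
  set d := dist (L.sender i) (L.receiver j)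
  set l := L.minLen Finset.univ
  -- The factor `1 / 8` fits both regimes: `(k - 1) / 2 - 2 ≥ (1 + k) / 8` for a coordinate
  -- difference `k ≥ 9`, and `1 - 3 / 4 ≥ 1 / 8` in a common square.
  by_cases h1 : (L.square o i).1 = (L.square o j).1
  · by_cases h2 : (L.square o i).2 = (L.square o j).2
    · have h12 : L.square o i = L.square o j := Prod.ext h1 h2
      have := dist_sender_le hL h12
      refine ⟨?_, ?_, fun h => absurd h12 h⟩
      · simp only [h1, sub_self, Int.cast_zero, abs_zero]
        linarith
      · simp only [h2, sub_self, Int.cast_zero, abs_zero]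
        linarith
    · have e := e2 h2
      have : 2 * l < d := by nlinarith
      refine ⟨?_, by nlinarith, fun _ => this⟩
      simp only [h1, sub_self, Int.cast_zero, abs_zero]
      linarith
  · have e := e1 h1
    have h2l : 2 * l < d := by nlinarith
    refine ⟨by nlinarith, ?_, fun _ => h2l⟩
    by_cases h2 : (L.square o i).2 = (L.square o j).2
    · simp only [h2, sub_self, Int.cast_zero, abs_zero]
      linarith
    · have e := e2 h2
      nlinarith

theorem isCluster_of_mem_clusters (hL : ∀ j i, L.sender j ≠ L.receiver i)
    (hE : L.Equilength Finset.univ) {C : Finset (Fin n)} (hC : C ∈ L.clusters o q) :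
    L.IsCluster C := by
  refine ⟨hE.mono (Finset.subset_univ _), ?_⟩
  obtain ⟨i, hi⟩ := nonempty_of_mem_clusters hC
  have hl : 0 < L.minLen Finset.univ := minLen_pos hL ⟨i, Finset.mem_univ i⟩
  have hle : L.minLen Finset.univ ≤ L.minLen C := minLen_anti (Finset.subset_univ _) ⟨i, hi⟩
  let h := L.minLen Finset.univ / 2
  have hh : 0 < h := half_pos hl
  refine ⟨!₂[o 0 + (L.square o i).1 * h, o 1 + (L.square o i).2 * h],
    EuclideanSpace.single 0 1, EuclideanSpace.single 1 1, by simp, by simp,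
    by simp [EuclideanSpace.inner_single_left], fun j hj => ?_⟩
  have key : ∀ (x c : ℝ) (z : ℤ), ⌊(x - c) / h⌋ = z →
      x - (c + z * h) ∈ Set.Icc 0 (L.minLen C / 2) := by
    intro x c z hz
    have h1 := Int.floor_le ((x - c) / h)
    have h2 := Int.lt_floor_add_one ((x - c) / h)
    rw [hz] at h1 h2
    rw [le_div_iff₀ hh] at h1
    rw [div_lt_iff₀ hh] at h2
    have : h ≤ L.minLen C / 2 := by simp only [h]; linarith
    exact ⟨by linarith, by linarith⟩
  have hsq := square_eq_of_mem_clusters hC hj hi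
  constructor
  · simpa [EuclideanSpace.inner_single_right] using key _ _ _ (congrArg Prod.fst hsq)
  · simpa [EuclideanSpace.inner_single_right] using key _ _ _ (congrArg Prod.snd hsq)

/-- The classes of the grid are well-separated. -/
theorem isWellSeparated_gridClass (hL : ∀ j i, L.sender j ≠ L.receiver i)
    (hE : L.Equilength Finset.univ) (o : Plane) (q : ZMod 9 × ZMod 9) :
    L.IsWellSeparated (L.gridClass o q) (L.clusters o q) := by
  refine ⟨hE.mono (Finset.subset_univ _), biUnion_clusters,
    fun C hC => isCluster_of_mem_clusters hL hE hC, fun C hC C' hC' hne =>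
    ⟨disjoint_clusters hC hC' hne, fun i hi j hj => ?_⟩⟩
  have hi' := subset_gridClass_of_mem_clusters hC hi
  have hj' := subset_gridClass_of_mem_clusters hC' hj
  have hsq : L.square o i ≠ L.square o j := fun h => hne (eq_of_square_eq hC hC' hi hj h)
  -- The class may have a larger minimum length than the whole set, but by a factor less than 2;
  -- hence the separation by twice the global minimum.
  have hlt : L.minLen (L.gridClass o q) < 2 * L.minLen Finset.univ :=
    (minLen_le hi').trans_lt (hE.len_lt (Finset.mem_univ i))
  exact lt_min (hlt.trans ((le_dist_sender_receiver hL hE hi' hj').2.2 hsq))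
    (hlt.trans ((le_dist_sender_receiver hL hE hj' hi').2.2 hsq.symm))

theorem dist_le_of_mem_clusters (hL : ∀ j i, L.sender j ≠ L.receiver i)
    (hE : L.Equilength Finset.univ) {C : Finset (Fin n)} (hC : C ∈ L.clusters o q) {i j : Fin n}
    (hi : i ∈ C) (hj : j ∈ C) : dist (L.sender i) (L.receiver j) ≤ 3 * L.minLen C := by
  have h1 := dist_sender_le hL (square_eq_of_mem_clusters hC hi hj)
  have h2 : L.minLen Finset.univ ≤ L.minLen C := minLen_anti (Finset.subset_univ _) ⟨i, hi⟩
  have h3 : dist (L.sender j) (L.receiver j) < 2 * L.minLen C :=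
    (hE.mono (Finset.subset_univ C)).len_lt hj
  have h4 := dist_triangle (L.sender i) (L.sender j) (L.receiver j)
  have h5 : 0 < L.minLen C := minLen_pos hL ⟨i, hi⟩
  linarith

end LinkSet

/-! ### Convergence of the path loss summed over squares -/

/-- Comparison with `1 / |k + 1 / 2| ^ s`: the half-integer shift keeps the base nonzero at every
integer. -/
theorem summable_one_add_abs_rpow {s : ℝ} (hs : 1 < s) :
    Summable fun k : ℤ => (1 + |(k : ℝ)|) ^ (-s) := by
  refine Summable.of_nonneg_of_le (fun k => by positivity) (fun k => ?_)
    ((Real.summable_one_div_int_add_rpow (1 / 2) s).2 hs)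
  have hne : (k : ℝ) + 1 / 2 ≠ 0 := by
    intro h
    have h2 : (2 * k + 1 : ℤ) = 0 := by
      have : (2 * (k : ℝ) + 1) = 0 := by linarith
      exact_mod_cast this
    omega
  rw [Real.rpow_neg (by positivity), one_div]
  refine inv_anti₀ (Real.rpow_pos_of_pos (abs_pos.2 hne) _)
    (Real.rpow_le_rpow (abs_nonneg _) ?_ (by linarith))
  refine (abs_add_le _ _).trans ?_
  rw [abs_of_pos (by norm_num : (0 : ℝ) < 1 / 2)]
  linarith

/-- The path losses to the squares of a grid have a bounded sum. -/
theorem exists_sum_grid_le {s : ℝ} (hs : 1 < s) : ∃ Z : ℝ, 0 < Z ∧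
    ∀ (F : Finset (ℤ × ℤ)) (w : ℤ × ℤ),
      ∑ z ∈ F, (1 + |((w.1 - z.1 : ℤ) : ℝ)|) ^ (-s) * (1 + |((w.2 - z.2 : ℤ) : ℝ)|) ^ (-s) ≤ Z := by
  have h1 := summable_one_add_abs_rpow hs
  have h2 : Summable fun z : ℤ × ℤ => (1 + |(z.1 : ℝ)|) ^ (-s) * (1 + |(z.2 : ℝ)|) ^ (-s) :=
    h1.mul_of_nonneg h1 (fun k => by positivity) (fun k => by positivity)
  refine ⟨∑' z : ℤ × ℤ, (1 + |(z.1 : ℝ)|) ^ (-s) * (1 + |(z.2 : ℝ)|) ^ (-s),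
    h2.tsum_pos (fun z => by positivity) 0 (by positivity), fun F w => ?_⟩
  -- The reflection `z ↦ w - z` turns the sum into a partial sum of one fixed series, so the bound
  -- is uniform in `F` and `w`.
  have h3 := h2.sum_le_tsum (F.image fun z => w - z) (fun z _ => by positivity)
  rwa [Finset.sum_image (fun a _ b _ h => sub_right_injective h)] at h3

/-! ### Cluster optima and measurability -/

/-- The maximum number of links in a feasible subset of `C`. -/
noncomputable def optOn {n : ℕ} (β : ℝ) (x : Fin n → Fin n → ℝ) (C : Finset (Fin n)) : ℕ :=
  open Classical in
  (Finset.univ.filter fun S : Finset (Fin n) => S ⊆ C ∧ IsFeasible β x S).sup Finset.card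

/-- The comparisons of received powers on which the algorithm and the optimum depend. -/
def profile {n : ℕ} (L : LinkSet n) (P α β c η : ℝ) (x : Fin n → Fin n → ℝ) :
    (Fin n × Fin n) ⊕ (Finset (Fin n) × Finset (Fin n) × Fin n) ⊕
      (Finset (Fin n) × Finset (Fin n) × Fin n) ⊕ (Finset (Fin n) × Fin n) ⊕ Finset (Fin n) → Prop
  | .inl (i, j) => x j j ≤ x i i
  | .inr (.inl (T, S, i)) => 2 * β * (S.card : ℝ) * (P / L.minLen T ^ α) < x i i
  | .inr (.inr (.inl (T, S, i))) => η * (S.card : ℝ) * (P / L.minLen T ^ α) ≤ x i i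
  | .inr (.inr (.inr (.inl (S, j)))) => affectance x S j < 2 * c
  | .inr (.inr (.inr (.inr S))) => IsFeasible β x S

section Profile

variable {n : ℕ} {L : LinkSet n} {P α β c η : ℝ} {x x' : Fin n → Fin n → ℝ}

theorem byStrength_congr (h : ∀ i j, x j j ≤ x i i ↔ x' j j ≤ x' i i) (T : Finset (Fin n)) :
    byStrength x T = byStrength x' T := by
  simp only [byStrength, h]

theorem clusterSelect_congr (h : profile L P α β c η x = profile L P α β c η x')
    (T : Finset (Fin n)) : clusterSelect L P α β x T = clusterSelect L P α β x' T := by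
  have h1 : ∀ (S : Finset (Fin n)) i, 2 * β * (S.card : ℝ) * (P / L.minLen T ^ α) < x i i ↔
      2 * β * (S.card : ℝ) * (P / L.minLen T ^ α) < x' i i := fun S i =>
    Eq.to_iff (congrFun h (.inr (.inl (T, S, i))))
  have h2 : ∀ i j, x j j ≤ x i i ↔ x' j j ≤ x' i i := fun i j =>
    Eq.to_iff (congrFun h (.inl (i, j)))
  simp only [clusterSelect, byStrength_congr h2, h1]

theorem goodSelect_congr (h : profile L P α β c η x = profile L P α β c η x')
    (T : Finset (Fin n)) : goodSelect L P α β η x T = goodSelect L P α β η x' T := by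
  classical
  have h1 : ∀ (S : Finset (Fin n)) i, η * (S.card : ℝ) * (P / L.minLen T ^ α) ≤ x i i ↔
      η * (S.card : ℝ) * (P / L.minLen T ^ α) ≤ x' i i := fun S i =>
    Eq.to_iff (congrFun h (.inr (.inr (.inl (T, S, i)))))
  simp only [goodSelect, clusterSelect_congr h, h1]

theorem isFeasible_congr (h : profile L P α β c η x = profile L P α β c η x')
    (S : Finset (Fin n)) : IsFeasible β x S ↔ IsFeasible β x' S :=
  Eq.to_iff (congrFun h (.inr (.inr (.inr (.inr S)))))

theorem selected_congr (h : profile L P α β c η x = profile L P α β c η x') (o : Plane)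
    (q : ZMod 9 × ZMod 9) : selected L P α β o x q = selected L P α β o x' q := by
  have h1 : clusterSelect L P α β x = clusterSelect L P α β x' := funext (clusterSelect_congr h)
  simp only [selected, h1]

theorem sparsified_congr (h : profile L P α β c η x = profile L P α β c η x') (o : Plane)
    (q : ZMod 9 × ZMod 9) : sparsified L P α β c o x q = sparsified L P α β c o x' q := by
  have h1 : ∀ S j, affectance x S j < 2 * c ↔ affectance x' S j < 2 * c := fun S j =>
    Eq.to_iff (congrFun h (.inr (.inr (.inr (.inl (S, j))))))
  simp only [sparsified, selected_congr h, h1]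

theorem opt_congr (h : profile L P α β c η x = profile L P α β c η x') : opt β x = opt β x' := by
  unfold opt
  congr 1
  ext S
  simp [isFeasible_congr h]

theorem optOn_congr (h : profile L P α β c η x = profile L P α β c η x') (C : Finset (Fin n)) :
    optOn β x C = optOn β x' C := by
  unfold optOn
  congr 1
  ext S
  simp [isFeasible_congr h]

theorem isOutput_congr (h : profile L P α β c η x = profile L P α β c η x') (o : Plane)
    (A : Finset (Fin n)) : IsOutput L P α β c o x A ↔ IsOutput L P α β c o x' A := by
  simp only [IsOutput, IsLargestFeasiblePart, sparsified_congr h, isFeasible_congr h]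

variable {Ω : Type*} [MeasurableSpace Ω] {X : Fin n → Fin n → Ω → ℝ}

theorem measurable_affectance (hX : ∀ j i, Measurable (X j i)) (S : Finset (Fin n)) (j : Fin n) :
    Measurable fun ω => affectance (fun j i => X j i ω) S j :=
  Finset.measurable_sum _ fun i _ => (hX i j).div (hX j j)

theorem measurable_profile (hX : ∀ j i, Measurable (X j i)) :
    Measurable fun ω => profile L P α β c η (fun j i => X j i ω) := by
  refine measurable_pi_iff.2 fun a => measurableSet_setOfPred.1 ?_
  rcases a with ⟨i, j⟩ | ⟨T, S, i⟩ | ⟨T, S, i⟩ | ⟨S, j⟩ | S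
  · exact measurableSet_le (hX j j) (hX i i)
  · exact measurableSet_lt measurable_const (hX i i)
  · exact measurableSet_le measurable_const (hX i i)
  · exact measurableSet_lt (measurable_affectance hX S j) measurable_const
  · have : {ω | IsFeasible β (fun j i => X j i ω) S} =
        ⋂ i ∈ S, {ω | β * ∑ j ∈ S.erase i, X j i ω < X i i ω} := by
      ext ω
      simp [IsFeasible]
    change MeasurableSet {ω | IsFeasible β (fun j i => X j i ω) S}
    rw [this]
    exact Finset.measurableSet_biInter _ fun i _ => measurableSet_lt
      ((Finset.measurable_sum _ fun j _ => hX j i).const_mul β) (hX i i)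

/-- A profile is one of finitely many truth assignments, so every function that factors through it
is measurable. The algorithm itself never has to be unfolded. -/
theorem measurable_of_profile (L : LinkSet n) (P α β c η : ℝ) (hX : ∀ j i, Measurable (X j i))
    {γ : Type*} [MeasurableSpace γ] {F : (Fin n → Fin n → ℝ) → γ}
    (hF : ∀ x x', profile L P α β c η x = profile L P α β c η x' → F x = F x') :
    Measurable fun ω => F (fun j i => X j i ω) := by
  intro t _
  have : (fun ω => F (fun j i => X j i ω)) ⁻¹' t =
      (fun ω => profile L P α β c η (fun j i => X j i ω)) ⁻¹'
        {v | ∃ x, profile L P α β c η x = v ∧ F x ∈ t} := by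
    ext ω
    constructor
    · exact fun h => ⟨_, rfl, h⟩
    · rintro ⟨x, hx, h⟩
      rw [hF _ _ hx] at h
      exact h
  rw [this]
  exact measurable_profile hX (Set.toFinite _).measurableSet

end Profile

/-! ### Existence and size of outputs -/

section Output

variable {n : ℕ} {L : LinkSet n} {P α β c : ℝ} {x : Fin n → Fin n → ℝ} {o : Plane}

theorem pos_of_mem_selected (hβ : 0 ≤ β) (hP : 0 ≤ P) {q : ZMod 9 × ZMod 9} {j : Fin n}
    (hj : j ∈ selected L P α β o x q) : 0 < x j j := by
  obtain ⟨C, -, hC⟩ := Finset.mem_biUnion.1 hj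
  exact pos_of_mem_clusterSelect hβ hP hC

theorem exists_isOutput (hβ : 0 < β) (hc : 0 < c) (hP : 0 ≤ P) (hx : ∀ j i, 0 ≤ x j i) :
    ∃ A, IsOutput L P α β c o x A := by
  classical
  have h1 : ∀ q, ∃ A, IsLargestFeasiblePart β x ⌈4 * c * β⌉₊ (sparsified L P α β c o x q) A :=
    fun q => exists_isLargestFeasiblePart hβ hc hx (Finset.filter_subset _ _)
      (fun j hj => pos_of_mem_selected hβ.le hP (Finset.mem_of_mem_filter j hj))
      (fun j hj => (Finset.mem_filter.1 hj).2)
  choose sol hsol using h1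
  obtain ⟨q, hq⟩ := Finite.exists_max fun q => (sol q).card
  exact ⟨sol q, sol, hsol, ⟨q, rfl⟩, hq⟩

theorem IsOutput.isFeasible {A : Finset (Fin n)} (h : IsOutput L P α β c o x A) :
    IsFeasible β x A := by
  obtain ⟨sol, h, ⟨q, rfl⟩, -⟩ := h
  exact (h q).isFeasible

theorem IsFeasible.card_le_opt {S : Finset (Fin n)} (h : IsFeasible β x S) : S.card ≤ opt β x := by
  classical
  exact Finset.le_sup (f := Finset.card) (Finset.mem_filter.2 ⟨Finset.mem_univ S, h⟩)

theorem opt_le : opt β x ≤ n := by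
  classical
  exact Finset.sup_le fun S _ => (Finset.card_le_univ S).trans_eq (Fintype.card_fin n)

/-- The total size of the sparsified sets is at most a constant factor larger than the output. -/
theorem IsOutput.sum_card_sparsified_le {A : Finset (Fin n)} (h : IsOutput L P α β c o x A) :
    ∑ q, (sparsified L P α β c o x q).card ≤ 81 * ⌈4 * c * β⌉₊ * A.card := by
  obtain ⟨sol, h, -, hmax⟩ := h
  calc ∑ q, (sparsified L P α β c o x q).card
      ≤ ∑ _q : ZMod 9 × ZMod 9, ⌈4 * c * β⌉₊ * A.card :=
        Finset.sum_le_sum fun q _ => (h q).card_le.trans (Nat.mul_le_mul_left _ (hmax q))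
    _ = 81 * ⌈4 * c * β⌉₊ * A.card := by
        rw [Finset.sum_const, Finset.card_univ, Fintype.card_prod, ZMod.card, smul_eq_mul]
        ring

variable {Ω : Type*} [MeasurableSpace Ω] {X : Fin n → Fin n → Ω → ℝ} {μ : Measure Ω}

/-- The output of the algorithm can be chosen as a random variable. -/
theorem exists_isRun (hX : ∀ j i, Measurable (X j i)) (h0 : ∀ᵐ ω ∂μ, ∀ j i, 0 ≤ X j i ω)
    (hβ : 0 < β) (hc : 0 < c) (hP : 0 ≤ P) : ∃ ALG, IsRun L P α β c o μ X ALG := by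
  classical
  let F : (Fin n → Fin n → ℝ) → Finset (Fin n) := fun x =>
    if h : ∃ A, IsOutput L P α β c o x A then h.choose else ∅
  have hF : ∀ x x', profile L P α β c 0 x = profile L P α β c 0 x' → F x = F x' := by
    intro x x' h
    have : (fun A => IsOutput L P α β c o x A) = fun A => IsOutput L P α β c o x' A :=
      funext fun A => propext (isOutput_congr h o A)
    simp only [F]
    simp only [this]
  refine ⟨fun ω => F fun j i => X j i ω, fun A => ?_, ?_⟩
  · have := measurable_of_profile (γ := Prop) L P α β c 0 hX (F := fun x => F x = A)
      (fun x x' h => by rw [hF x x' h])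
    exact measurableSet_setOfPred.2 this
  · filter_upwards [h0] with ω hω
    have h := exists_isOutput (L := L) (α := α) (o := o) hβ hc hP hω
    have hFe : F (fun j i => X j i ω) = h.choose := dif_pos h
    rw [hFe]
    exact h.choose_spec

end Output

/-! ### A lower tail bound -/

section Chernoff

variable {Ω : Type*} [MeasurableSpace Ω] {μ : Measure Ω} [IsProbabilityMeasure μ]

/-- With `q` the probability of `B`, the left side is `1 - (1 - e⁻¹) q ≤ 1 - q / 2`, as `e ≥ 2`. -/
theorem mgf_indicator_neg_one_le {Y : Ω → ℝ} (hY : Measurable Y) {B : Set ℝ}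
    (hB : MeasurableSet B) :
    mgf (fun ω => B.indicator 1 (Y ω)) μ (-1) ≤ Real.exp (-(μ.real (Y ⁻¹' B) / 2)) := by
  have he : Real.exp (-1) ≤ 1 / 2 := by
    rw [Real.exp_neg, ← one_div]
    refine one_div_le_one_div_of_le (by norm_num) ?_
    have := Real.add_one_le_exp (1 : ℝ)
    linarith
  have h1 : (fun ω => Real.exp (-1 * B.indicator (1 : ℝ → ℝ) (Y ω))) =
      fun ω => 1 - (1 - Real.exp (-1)) * (Y ⁻¹' B).indicator (1 : Ω → ℝ) ω := by
    funext ω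
    by_cases h : Y ω ∈ B
    · rw [Set.indicator_of_mem h, Set.indicator_of_mem (show ω ∈ Y ⁻¹' B from h)]
      simp
    · rw [Set.indicator_of_notMem h, Set.indicator_of_notMem (show ω ∉ Y ⁻¹' B from h)]
      simp
  have hint : Integrable ((Y ⁻¹' B).indicator (1 : Ω → ℝ)) μ :=
    (integrable_const (1 : ℝ)).indicator (hY hB)
  rw [mgf, h1, integral_sub (integrable_const _) (hint.const_mul _), integral_const_mul,
    integral_indicator_one (hY hB)]
  simp only [integral_const, probReal_univ, smul_eq_mul, mul_one]
  refine le_trans ?_ (Real.add_one_le_exp _)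
  have := measureReal_nonneg (μ := μ) (s := Y ⁻¹' B)
  nlinarith

open Classical in
/-- A lower tail bound for the number of independent events that occur. -/
theorem measureReal_card_filter_le_le {ι : Type*} {Y : ι → Ω → ℝ} (hind : iIndepFun Y μ)
    (hY : ∀ i, Measurable (Y i)) {B : ι → Set ℝ} (hB : ∀ i, MeasurableSet (B i)) (s : Finset ι)
    {ν : ℝ} (hν : ν ≤ ∑ i ∈ s, μ.real (Y i ⁻¹' B i)) :
    μ.real {ω | ((s.filter fun i => Y i ω ∈ B i).card : ℝ) ≤ ν / 4} ≤ Real.exp (-(ν / 4)) := by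
  let Z : ι → Ω → ℝ := fun i ω => (B i).indicator 1 (Y i ω)
  have hm : ∀ i, Measurable ((B i).indicator (1 : ℝ → ℝ)) := fun i =>
    measurable_one.indicator (hB i)
  have hZ : ∀ i, Measurable (Z i) := fun i => (hm i).comp (hY i)
  have hZind : iIndepFun Z μ := hind.comp (fun i => (B i).indicator 1) hm
  have hcard : ∀ ω, ((s.filter fun i => Y i ω ∈ B i).card : ℝ) = (∑ i ∈ s, Z i) ω := by
    intro ω
    simp [Z, Finset.sum_apply, Set.indicator_apply, Finset.sum_boole]
  have hnn : ∀ ω, 0 ≤ (∑ i ∈ s, Z i) ω := fun ω => by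
    rw [← hcard]
    positivity
  have hsum : Measurable (∑ i ∈ s, Z i) := by
    convert Finset.measurable_sum s fun i _ => hZ i using 1
    ext ω
    simp
  have hint : Integrable (fun ω => Real.exp (-1 * (∑ i ∈ s, Z i) ω)) μ := by
    refine Integrable.of_bound (C := 1) ?_ (Filter.Eventually.of_forall fun ω => ?_)
    · exact (Real.measurable_exp.comp (hsum.const_mul (-1))).aestronglyMeasurable
    · rw [Real.norm_eq_abs, abs_of_pos (Real.exp_pos _), Real.exp_le_one_iff]
      linarith [hnn ω]
  -- The exponential Markov inequality at `-1` yields `exp (ν / 4) * exp (-ν / 2)`.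
  have h1 := measure_le_le_exp_mul_mgf (X := ∑ i ∈ s, Z i) (μ := μ) (ν / 4) (t := -1)
    (by norm_num) hint
  rw [hZind.mgf_sum hZ] at h1
  simp_rw [hcard]
  refine h1.trans ?_
  have h2 : ∏ i ∈ s, mgf (Z i) μ (-1) ≤ ∏ i ∈ s, Real.exp (-(μ.real (Y i ⁻¹' B i) / 2)) :=
    Finset.prod_le_prod (fun i _ => mgf_nonneg) fun i _ => mgf_indicator_neg_one_le (hY i) (hB i)
  rw [← Real.exp_sum, Finset.sum_neg_distrib, ← Finset.sum_div] at h2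
  refine (mul_le_mul_of_nonneg_left h2 (Real.exp_pos _).le).trans ?_
  rw [← Real.exp_add, Real.exp_le_exp]
  linarith

theorem integrable_natCast_of_le {f : Ω → ℕ} (hf : Measurable f) {N : ℕ} (h : ∀ ω, f ω ≤ N) :
    Integrable (fun ω => (f ω : ℝ)) μ := by
  refine Integrable.of_bound (C := N)
    ((measurable_from_top (f := fun k : ℕ => (k : ℝ))).comp hf).aestronglyMeasurable
    (Filter.Eventually.of_forall fun ω => ?_)
  rw [Real.norm_natCast]
  exact_mod_cast h ω

end Chernoff

/-! ### Consequences of the shadowing model -/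

section Shadowing

variable {n : ℕ} {L : LinkSet n} {P α β : ℝ}

theorem LinkSet.gain_pos (hL : ∀ j i, L.sender j ≠ L.receiver i) (hP : 0 < P) (j i : Fin n) :
    0 < L.gain P α j i :=
  div_pos hP (Real.rpow_pos_of_pos (dist_pos.2 (hL j i)) _)

variable {D : SSDistribution} {Ω : Type*} [MeasurableSpace Ω] {μ : Measure Ω}
  {X : Fin n → Fin n → Ω → ℝ}

theorem IsShadowing.nonneg (h : IsShadowing D L P α μ X)
    (hL : ∀ j i, L.sender j ≠ L.receiver i) (hP : 0 < P) : ∀ᵐ ω ∂μ, ∀ j i, 0 ≤ X j i ω := by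
  refine ae_all_iff.2 fun j => ae_all_iff.2 fun i => ?_
  have h1 := D.nonneg _ (LinkSet.gain_pos (α := α) hL hP j i)
  rw [← h.law j i] at h1
  exact ae_of_ae_map (h.measurable j i).aemeasurable h1

theorem IsShadowing.integrable (h : IsShadowing D L P α μ X)
    (hL : ∀ j i, L.sender j ≠ L.receiver i) (hP : 0 < P) (j i : Fin n) :
    Integrable (X j i) μ := by
  have h1 := D.integrable _ (LinkSet.gain_pos (α := α) hL hP j i)
  rw [← h.law j i] at h1
  exact (integrable_map_measure measurable_id.aestronglyMeasurable
    (h.measurable j i).aemeasurable).1 h1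

theorem IsShadowing.integral_eq (h : IsShadowing D L P α μ X)
    (hL : ∀ j i, L.sender j ≠ L.receiver i) (hP : 0 < P) (j i : Fin n) :
    ∫ ω, X j i ω ∂μ = L.gain P α j i := by
  have h1 := D.mean _ (LinkSet.gain_pos (α := α) hL hP j i)
  rw [← h.law j i] at h1
  rw [← h1]
  exact (integral_map (f := fun x : ℝ => x) (h.measurable j i).aemeasurable
    measurable_id.aestronglyMeasurable).symm

theorem IsShadowing.measureReal_preimage_Ioi (h : IsShadowing D L P α μ X) (j i : Fin n) (t : ℝ) :
    μ.real (X j i ⁻¹' Set.Ioi t) = (D.law (L.gain P α j i)).real (Set.Ioi t) := by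
  rw [← h.law j i, map_measureReal_apply (h.measurable j i) measurableSet_Ioi]

theorem le_measureReal_Ioi_of_smooth {p c₀ m : ℝ} (hm : 0 < m)
    (h : ∃ x, (D.law m).real (Set.Ioi x) = p ∧ c₀ * m ≤ x) :
    p ≤ (D.law m).real (Set.Ioi (c₀ * m)) := by
  obtain ⟨x, rfl, hx⟩ := h
  have := D.isProbabilityMeasure m hm
  exact measureReal_mono (Set.Ioi_subset_Ioi hx)

/-- If `g` is large, then a link has a strength larger than its mean by the factor `t` with probability
at least `t / N`. -/
theorem div_le_tail {m t : ℝ} (hm : 0 < m) {N : ℕ} (ht : 1 ≤ t) (h : t < D.g m N) :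
    t / N ≤ D.tail m t := by
  have := D.isProbabilityMeasure m hm
  have h1 := (lt_max_iff.1 h).resolve_left (not_lt.2 ht)
  -- An empty set would have the default supremum 0, which `t ≥ 1` excludes.
  have hne : {t : ℝ | 0 ≤ t ∧ D.tail m t ∈ Set.Icc (t / N) (2 * t / N)}.Nonempty := by
    by_contra hempty
    rw [Set.not_nonempty_iff_eq_empty] at hempty
    rw [hempty, Real.sSup_empty] at h1
    linarith
  -- The supremum need not be attained: a point `u > t` of the set suffices, because the tail is
  -- nonincreasing.
  obtain ⟨u, ⟨-, hu, -⟩, htu⟩ := exists_lt_of_lt_csSup hne h1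
  refine (div_le_div_of_nonneg_right htu.le N.cast_nonneg).trans (hu.trans ?_)
  exact measureReal_mono (Set.Ioi_subset_Ioi (mul_le_mul_of_nonneg_right htu.le hm.le))

end Shadowing

/-! ### The optimum of a cluster against the greedy selection -/

section Cluster

variable {n : ℕ} {L : LinkSet n} {P α β : ℝ} {o : Plane} {q : ZMod 9 × ZMod 9}
  {C : Finset (Fin n)}

theorem le_gain_of_mem_clusters (hα : 0 ≤ α) (hP : 0 < P) (hL : ∀ j i, L.sender j ≠ L.receiver i)
    (hE : L.Equilength Finset.univ) (hC : C ∈ L.clusters o q) {i j : Fin n} (hi : i ∈ C)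
    (hj : j ∈ C) : (3 : ℝ) ^ (-α) * (P / L.minLen C ^ α) ≤ L.gain P α j i := by
  have h0 : 0 < L.minLen C := LinkSet.minLen_pos hL ⟨i, hi⟩
  have h1 := LinkSet.dist_le_of_mem_clusters hL hE hC hj hi
  have h2 : dist (L.sender j) (L.receiver i) ^ α ≤ (3 : ℝ) ^ α * L.minLen C ^ α := by
    rw [← Real.mul_rpow (by norm_num) h0.le]
    exact Real.rpow_le_rpow dist_nonneg h1 hα
  have h3 : 0 < dist (L.sender j) (L.receiver i) ^ α :=
    Real.rpow_pos_of_pos (dist_pos.2 (hL j i)) _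
  calc (3 : ℝ) ^ (-α) * (P / L.minLen C ^ α) = P / ((3 : ℝ) ^ α * L.minLen C ^ α) := by
        rw [Real.rpow_neg (by norm_num)]
        field_simp
    _ ≤ _ := div_le_div_of_nonneg_left hP.le h3 h2

theorem le_gain_self (hα : 0 ≤ α) (hP : 0 < P) (hL : ∀ j i, L.sender j ≠ L.receiver i)
    (hE : L.Equilength C) {i : Fin n} (hi : i ∈ C) :
    (2 : ℝ) ^ (-α) * (P / L.minLen C ^ α) ≤ L.gain P α i i := by
  have h0 : 0 < L.minLen C := LinkSet.minLen_pos hL ⟨i, hi⟩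
  have h1 : dist (L.sender i) (L.receiver i) < 2 * L.minLen C := hE.len_lt hi
  have h2 : dist (L.sender i) (L.receiver i) ^ α ≤ (2 : ℝ) ^ α * L.minLen C ^ α := by
    rw [← Real.mul_rpow (by norm_num) h0.le]
    exact Real.rpow_le_rpow dist_nonneg h1.le hα
  have h3 : 0 < dist (L.sender i) (L.receiver i) ^ α :=
    Real.rpow_pos_of_pos (dist_pos.2 (hL i i)) _
  calc (2 : ℝ) ^ (-α) * (P / L.minLen C ^ α) = P / ((2 : ℝ) ^ α * L.minLen C ^ α) := by
        rw [Real.rpow_neg (by norm_num)]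
        field_simp
    _ ≤ _ := div_le_div_of_nonneg_left hP.le h3 h2

theorem sender_power_pos (hP : 0 < P) (hL : ∀ j i, L.sender j ≠ L.receiver i)
    (hC : C.Nonempty) : 0 < P / L.minLen C ^ α :=
  div_pos hP (Real.rpow_pos_of_pos (LinkSet.minLen_pos hL hC) _)

open Classical in
/-- The ordered pairs of links of `S` with an interference of at least the order of its mean. -/
noncomputable def strongPairs (L : LinkSet n) (P α c₀ : ℝ) (x : Fin n → Fin n → ℝ)
    (S : Finset (Fin n)) : Finset (Fin n × Fin n) :=
  S.offDiag.filter fun e => x e.1 e.2 ∈ Set.Ioi (c₀ * L.gain P α e.1 e.2)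

open Classical in
theorem card_strongPairs {c₀ : ℝ} {x : Fin n → Fin n → ℝ} (S : Finset (Fin n)) :
    (strongPairs L P α c₀ x S).card =
      ∑ i ∈ S, ((S.erase i).filter fun j => x j i ∈ Set.Ioi (c₀ * L.gain P α j i)).card := by
  have h : ∀ e ∈ strongPairs L P α c₀ x S, e.2 ∈ S := fun e he =>
    (Finset.mem_offDiag.1 (Finset.mem_filter.1 he).1).2.1
  rw [Finset.card_eq_sum_card_fiberwise h]
  refine Finset.sum_congr rfl fun i hi => ?_
  refine Finset.card_bij (fun e _ => e.1) ?_ ?_ ?_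
  · rintro ⟨j, i'⟩ he
    simp only [strongPairs, Finset.mem_filter, Finset.mem_offDiag] at he
    obtain ⟨⟨⟨h1, h2, h3⟩, h4⟩, rfl⟩ := he
    exact Finset.mem_filter.2 ⟨Finset.mem_erase.2 ⟨h3, h1⟩, h4⟩
  · rintro ⟨j, i'⟩ he ⟨j', i''⟩ he' hj
    have h1 := (Finset.mem_filter.1 he).2
    have h2 := (Finset.mem_filter.1 he').2
    exact Prod.ext hj (h1.trans h2.symm)
  · intro j hj
    obtain ⟨h1, h2⟩ := Finset.mem_filter.1 hj
    obtain ⟨h3, h4⟩ := Finset.mem_erase.1 h1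
    refine ⟨(j, i), ?_, rfl⟩
    simp only [strongPairs, Finset.mem_filter, Finset.mem_offDiag]
    exact ⟨⟨⟨h4, hi, h3⟩, h2⟩, trivial⟩

/-- A feasible subset of a cluster in which many interferences are of the order of the mean is at most
a constant factor larger than the set that the algorithm selects. -/
theorem mul_card_le_of_isFeasible {p c₀ δ : ℝ} (hα : 0 ≤ α) (hβ : 0 < β) (hp : 0 < p)
    (hc₀ : 0 < c₀) (hδ0 : 0 < δ)
    (hδ : δ ≤ p / 8) (hδ' : δ ≤ c₀ * (3 : ℝ) ^ (-α) * p / 32)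
    (hP : 0 < P) (hL : ∀ j i, L.sender j ≠ L.receiver i) (hE : L.Equilength Finset.univ)
    (hC : C ∈ L.clusters o q) {x : Fin n → Fin n → ℝ} (hx : ∀ j i, 0 ≤ x j i)
    {S : Finset (Fin n)} (hSC : S ⊆ C) (hS : IsFeasible β x S) (h2 : 2 ≤ S.card)
    (hstrong : p * ((S.card : ℝ) * (S.card - 1)) / 4 < (strongPairs L P α c₀ x S).card) :
    δ * S.card ≤ (clusterSelect L P α β x C).card + 1 := by
  classical
  set s := P / L.minLen C ^ α with hs
  have hs0 : 0 < s := sender_power_pos hP hL (LinkSet.nonempty_of_mem_clusters hC)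
  let cnt : Fin n → ℕ := fun i =>
    ((S.erase i).filter fun j => x j i ∈ Set.Ioi (c₀ * L.gain P α j i)).card
  have h2' : (2 : ℝ) ≤ S.card := by exact_mod_cast h2
  let H := S.filter fun i => p * ((S.card : ℝ) - 1) / 8 ≤ cnt i
  have hcnt : ∀ i ∈ S, (cnt i : ℝ) ≤ (S.card : ℝ) - 1 := by
    intro i hi
    have h3 : cnt i ≤ (S.erase i).card := Finset.card_filter_le _ _
    rw [Finset.card_erase_of_mem hi] at h3
    have : cnt i + 1 ≤ S.card := by omega
    have : (cnt i : ℝ) + 1 ≤ S.card := by exact_mod_cast this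
    linarith
  -- Averaging: links outside `H` receive at most half of the `p k (k - 1) / 4` strong
  -- interferences, where `k = |S|`, and a link of `H` receives at most `k - 1`.
  have hH : p * (S.card : ℝ) / 8 < H.card := by
    have h3 : ((strongPairs L P α c₀ x S).card : ℝ) ≤
        ∑ i ∈ S, ((if i ∈ H then (S.card : ℝ) - 1 else 0) + p * ((S.card : ℝ) - 1) / 8) := by
      rw [card_strongPairs, Nat.cast_sum]
      refine Finset.sum_le_sum fun i hi => ?_
      have h4 := hcnt i hi
      have h5 : 0 ≤ p * ((S.card : ℝ) - 1) / 8 := by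
        have : 0 ≤ (S.card : ℝ) - 1 := by linarith
        positivity
      by_cases hiH : i ∈ H
      · rw [if_pos hiH]
        exact h4.trans (by linarith)
      · rw [if_neg hiH, zero_add]
        have h6 : ¬ p * ((S.card : ℝ) - 1) / 8 ≤ cnt i := fun h =>
          hiH (Finset.mem_filter.2 ⟨hi, h⟩)
        exact (not_le.1 h6).le
    rw [Finset.sum_add_distrib, Finset.sum_const, nsmul_eq_mul, ← Finset.sum_filter,
      Finset.sum_const, nsmul_eq_mul] at h3
    have h4 : S.filter (fun i => i ∈ H) = H :=
      Finset.filter_mem_eq_inter.trans (Finset.inter_eq_right.2 (Finset.filter_subset _ _))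
    rw [h4] at h3
    have h5 : 0 < (S.card : ℝ) - 1 := by linarith
    have h6 : (p * (S.card : ℝ) / 8) * ((S.card : ℝ) - 1) < H.card * ((S.card : ℝ) - 1) := by
      nlinarith
    exact lt_of_mul_lt_mul_right h6 h5.le
  -- As `k - 1 ≥ k / 2`, a link of `H` has at least `p k / 16` interferers of size at least `c₀
  -- 3^(-α) s`, and feasibility forces its signal above `β` times their sum. The 32 in `hδ'` is this
  -- 16 times the 2 of the greedy threshold.
  have hstr : ∀ i ∈ H, 2 * β * s * (δ * S.card) < x i i := by
    intro i hi
    obtain ⟨hiS, hi⟩ := Finset.mem_filter.1 hi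
    refine lt_of_le_of_lt ?_ (hS i hiS)
    have h3 : (cnt i : ℝ) * (c₀ * ((3 : ℝ) ^ (-α) * s)) ≤ ∑ j ∈ S.erase i, x j i := by
      refine le_trans ?_ (Finset.sum_le_sum_of_subset_of_nonneg (Finset.filter_subset
        (fun j => x j i ∈ Set.Ioi (c₀ * L.gain P α j i)) _) fun j _ _ => hx j i)
      rw [← nsmul_eq_mul]
      refine Finset.card_nsmul_le_sum _ _ _ fun j hj => ?_
      obtain ⟨h4, h5⟩ := Finset.mem_filter.1 hj
      refine le_trans ?_ (Set.mem_Ioi.1 h5).le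
      exact mul_le_mul_of_nonneg_left (le_gain_of_mem_clusters hα hP hL hE hC (hSC hiS)
        (hSC (Finset.mem_of_mem_erase h4))) hc₀.le
    have h3a : (0 : ℝ) < (3 : ℝ) ^ (-α) := Real.rpow_pos_of_pos (by norm_num) _
    set w := (3 : ℝ) ^ (-α)
    have h4 : p * (S.card : ℝ) / 16 ≤ cnt i := by nlinarith
    have h5 := mul_le_mul_of_nonneg_right h4 (by positivity : 0 ≤ c₀ * (w * s))
    have h6 : 2 * s * (δ * S.card) ≤ p * (S.card : ℝ) / 16 * (c₀ * (w * s)) := by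
      have := mul_le_mul_of_nonneg_right hδ' (by positivity : 0 ≤ 2 * s * S.card)
      calc 2 * s * (δ * S.card) = δ * (2 * s * S.card) := by ring
        _ ≤ _ := this
        _ = _ := by ring
    have h7 := mul_le_mul_of_nonneg_left ((h6.trans h5).trans h3) hβ.le
    calc 2 * β * s * (δ * S.card) = β * (2 * s * (δ * S.card)) := by ring
      _ ≤ _ := h7
  have hr : ⌊δ * S.card⌋₊ ≤ (clusterSelect L P α β x C).card := by
    have hfl : (⌊δ * S.card⌋₊ : ℝ) ≤ δ * S.card := Nat.floor_le (by positivity)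
    refine le_card_clusterSelect hβ.le hP.le ?_
    have h3 : ⌊δ * S.card⌋₊ ≤ H.card := by
      have : (⌊δ * S.card⌋₊ : ℝ) ≤ H.card := by
        have := mul_le_mul_of_nonneg_right hδ (by positivity : (0 : ℝ) ≤ S.card)
        linarith
      exact_mod_cast this
    refine h3.trans (Finset.card_le_card fun i hi => Finset.mem_filter.2
      ⟨hSC (Finset.mem_filter.1 hi).1, lt_of_le_of_lt ?_ (hstr i hi)⟩)
    exact mul_le_mul_of_nonneg_left (by linarith) (by positivity)
  have h3 := Nat.lt_floor_add_one (δ * (S.card : ℝ))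
  have h4 : (⌊δ * S.card⌋₊ : ℝ) ≤ (clusterSelect L P α β x C).card := by exact_mod_cast hr
  linarith

-- An optimal set has enough strong pairs and is charged to the greedy selection, or it has fewer
-- than `k₀` links, or it appears in the last sum. That sum is the union bound, with `C.card` as the
-- trivial bound on the optimum.
open Classical in
theorem optOn_le {p c₀ δ : ℝ} (hα : 0 ≤ α) (hβ : 0 < β) (hp : 0 < p)
    (hc₀ : 0 < c₀) (hδ0 : 0 < δ)
    (hδ : δ ≤ p / 8) (hδ' : δ ≤ c₀ * (3 : ℝ) ^ (-α) * p / 32)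
    (hP : 0 < P) (hL : ∀ j i, L.sender j ≠ L.receiver i) (hE : L.Equilength Finset.univ)
    (hC : C ∈ L.clusters o q) {x : Fin n → Fin n → ℝ} (hx : ∀ j i, 0 ≤ x j i) {k₀ : ℝ}
    (hk₀ : 2 ≤ k₀) :
    (optOn β x C : ℝ) ≤ ((clusterSelect L P α β x C).card + 1) / δ + k₀ +
      C.card * ∑ S ∈ C.powerset.filter fun S => k₀ ≤ S.card,
        if ((strongPairs L P α c₀ x S).card : ℝ) ≤ p * ((S.card : ℝ) * (S.card - 1)) / 4
          then (1 : ℝ) else 0 := by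
  have hne : (Finset.univ.filter fun S : Finset (Fin n) => S ⊆ C ∧ IsFeasible β x S).Nonempty :=
    ⟨∅, Finset.mem_filter.2 ⟨Finset.mem_univ _, Finset.empty_subset _, fun i hi => by simp at hi⟩⟩
  obtain ⟨S, hS, hopt⟩ := Finset.exists_mem_eq_sup _ hne Finset.card
  obtain ⟨-, hSC, hS⟩ := Finset.mem_filter.1 hS
  have hopt' : optOn β x C = S.card := by
    unfold optOn
    convert hopt
  rw [hopt']
  have hnn : ∀ T ∈ C.powerset.filter fun S => k₀ ≤ S.card, (0 : ℝ) ≤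
      if ((strongPairs L P α c₀ x T).card : ℝ) ≤ p * ((T.card : ℝ) * (T.card - 1)) / 4
        then (1 : ℝ) else 0 := fun T _ => by split_ifs <;> norm_num
  have h1 : (0 : ℝ) ≤ ((clusterSelect L P α β x C).card + 1) / δ := by positivity
  have h2 := mul_nonneg (Nat.cast_nonneg (α := ℝ) C.card) (Finset.sum_nonneg hnn)
  by_cases hk : k₀ ≤ S.card
  · by_cases hbad :
        ((strongPairs L P α c₀ x S).card : ℝ) ≤ p * ((S.card : ℝ) * (S.card - 1)) / 4
    · have hmem : S ∈ C.powerset.filter fun S => k₀ ≤ (S.card : ℝ) :=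
        Finset.mem_filter.2 ⟨Finset.mem_powerset.2 hSC, hk⟩
      have h3 := Finset.single_le_sum hnn hmem
      rw [if_pos hbad] at h3
      have h4 : (S.card : ℝ) ≤ C.card := by exact_mod_cast Finset.card_le_card hSC
      have h5 := mul_le_mul_of_nonneg_left h3 (Nat.cast_nonneg (α := ℝ) C.card)
      linarith
    · have hcard : 2 ≤ S.card := by
        have : (2 : ℝ) ≤ S.card := hk₀.trans hk
        exact_mod_cast this
      have h3 := mul_card_le_of_isFeasible hα hβ hp hc₀ hδ0 hδ hδ' hP hL hE hC hx hSC hS hcard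
        (not_le.1 hbad)
      have h4 : (S.card : ℝ) ≤ ((clusterSelect L P α β x C).card + 1) / δ := by
        rw [le_div_iff₀ hδ0]
        linarith
      linarith
  · linarith [not_le.1 hk]

theorem optOn_le_card {x : Fin n → Fin n → ℝ} : optOn β x C ≤ n := by
  classical
  exact Finset.sup_le fun S _ => (Finset.card_le_univ S).trans_eq (Fintype.card_fin n)

variable {D : SSDistribution} {Ω : Type*} [MeasurableSpace Ω] {μ : Measure Ω}
  [IsProbabilityMeasure μ] {X : Fin n → Fin n → Ω → ℝ}

theorem measurable_card_clusterSelect (hX : ∀ j i, Measurable (X j i)) :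
    Measurable fun ω => (clusterSelect L P α β (fun j i => X j i ω) C).card :=
  measurable_of_profile L P α β 0 0 hX
    (F := fun x => (clusterSelect L P α β x C).card) fun x x' h => by rw [clusterSelect_congr h]

theorem integrable_card_clusterSelect (hX : ∀ j i, Measurable (X j i)) :
    Integrable (fun ω => ((clusterSelect L P α β (fun j i => X j i ω) C).card : ℝ)) μ :=
  integrable_natCast_of_le (measurable_card_clusterSelect hX) (N := n)
    fun _ => (Finset.card_le_univ _).trans_eq (Fintype.card_fin n)

theorem measurable_optOn (L : LinkSet n) (P α : ℝ) (hX : ∀ j i, Measurable (X j i)) :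
    Measurable fun ω => optOn β (fun j i => X j i ω) C :=
  measurable_of_profile L P α β 0 0 hX (F := fun x => optOn β x C) fun _ _ h => optOn_congr h C

theorem integrable_optOn (L : LinkSet n) (P α : ℝ) (hX : ∀ j i, Measurable (X j i)) :
    Integrable (fun ω => (optOn β (fun j i => X j i ω) C : ℝ)) μ :=
  integrable_natCast_of_le (measurable_optOn L P α hX) fun _ => optOn_le_card

/-- Ordered pairs carry independent interferences, each strong with probability at least `p`; so the
Chernoff exponent is quadratic in the size of `S`. -/
theorem measureReal_strongPairs_le {p c₀ : ℝ}
    (hsm : ∀ m, 0 < m → ∃ x, (D.law m).real (Set.Ioi x) = p ∧ c₀ * m ≤ x) (hP : 0 < P)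
    (hL : ∀ j i, L.sender j ≠ L.receiver i) (hX : IsShadowing D L P α μ X) (S : Finset (Fin n)) :
    μ.real {ω | ((strongPairs L P α c₀ (fun j i => X j i ω) S).card : ℝ) ≤
      p * ((S.card : ℝ) * (S.card - 1)) / 4} ≤
      Real.exp (-(p * ((S.card : ℝ) * (S.card - 1)) / 4)) := by
  refine measureReal_card_filter_le_le hX.indep (fun e => hX.measurable e.1 e.2)
    (B := fun e => Set.Ioi (c₀ * L.gain P α e.1 e.2)) (fun e => measurableSet_Ioi) S.offDiag ?_
  have h1 : ∀ e ∈ S.offDiag, p ≤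
      μ.real (X e.1 e.2 ⁻¹' Set.Ioi (c₀ * L.gain P α e.1 e.2)) := fun e _ => by
    rw [hX.measureReal_preimage_Ioi]
    exact le_measureReal_Ioi_of_smooth (LinkSet.gain_pos hL hP _ _)
      (hsm _ (LinkSet.gain_pos hL hP _ _))
  refine le_trans (le_of_eq ?_) (Finset.card_nsmul_le_sum _ _ _ h1)
  have : ((S.card * S.card - S.card : ℕ) : ℝ) = S.card * (S.card - 1) := by
    rw [Nat.cast_sub (Nat.le_mul_self _)]
    push_cast
    ring
  rw [Finset.offDiag_card, nsmul_eq_mul, this, mul_comm]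

/-- Large sets are unlikely to have few strong interferences. -/
theorem card_mul_sum_exp_le {p k₀ : ℝ} (hp : 0 < p) (hC : C.Nonempty)
    (hk₀ : k₀ = 8 * Real.log C.card / p + 2) :
    C.card * ∑ S ∈ C.powerset.filter (fun S => k₀ ≤ S.card),
      Real.exp (-(p * ((S.card : ℝ) * (S.card - 1)) / 4)) ≤ 3 := by
  have hN : (1 : ℝ) ≤ C.card := by exact_mod_cast hC.card_pos
  have hN0 : (0 : ℝ) < C.card := by linarith
  have hlog : 0 ≤ Real.log C.card := Real.log_nonneg hN
  set N : ℝ := (C.card : ℝ) with hNdef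
  -- For `k ≥ k₀` one has `p (k - 1) ≥ 8 log N`, so the exponent is at least `2 k log N ≥ (1 + k)
  -- log N`. One factor `1 / N` cancels the prefactor, and the sum of `N^(-k)` over all subsets is
  -- `(1 + 1 / N)^N ≤ e`.
  have h1 : ∀ S ∈ C.powerset.filter (fun S => k₀ ≤ (S.card : ℝ)),
      Real.exp (-(p * ((S.card : ℝ) * (S.card - 1)) / 4)) ≤ N⁻¹ * (1 / N) ^ S.card := by
    intro S hS
    have hk := (Finset.mem_filter.1 hS).2
    set k : ℝ := (S.card : ℝ) with hkdef
    have hk2 : 2 ≤ k := by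
      have : 0 ≤ 8 * Real.log N / p := by positivity
      linarith
    have h2 : 8 * Real.log N ≤ p * (k - 1) := by
      have : 8 * Real.log N / p ≤ k - 1 := by linarith
      rwa [div_le_iff₀ hp, mul_comm _ p] at this
    have h3 : N⁻¹ * (1 / N) ^ S.card = Real.exp (-(Real.log N * (1 + k))) := by
      rw [one_div, ← Real.exp_log hN0, ← Real.exp_neg, ← Real.exp_nat_mul, ← Real.exp_add,
        Real.exp_log hN0, ← hkdef]
      congr 1
      ring
    rw [h3, Real.exp_le_exp]
    nlinarith
  have h2 : ∑ S ∈ C.powerset.filter (fun S => k₀ ≤ (S.card : ℝ)),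
      Real.exp (-(p * ((S.card : ℝ) * (S.card - 1)) / 4)) ≤ N⁻¹ * (1 + 1 / N) ^ C.card := by
    refine (Finset.sum_le_sum h1).trans ?_
    refine (Finset.sum_le_sum_of_subset_of_nonneg (Finset.filter_subset _ _)
      fun S _ _ => by positivity).trans ?_
    rw [← Finset.mul_sum, add_comm 1 (1 / N), ← Finset.sum_pow_mul_eq_add_pow]
    simp
  have h3 : (1 + 1 / N) ^ C.card ≤ 3 := by
    have h4 : (1 + 1 / N) ^ C.card ≤ Real.exp (1 / N) ^ C.card :=
      pow_le_pow_left₀ (by positivity) (by linarith [Real.add_one_le_exp (1 / N)]) _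
    rw [← Real.exp_nat_mul, ← hNdef, mul_one_div_cancel hN0.ne'] at h4
    linarith [Real.exp_one_lt_d9]
  calc N * _ ≤ N * (N⁻¹ * (1 + 1 / N) ^ C.card) := mul_le_mul_of_nonneg_left h2 hN0.le
    _ = (1 + 1 / N) ^ C.card := by rw [← mul_assoc, mul_inv_cancel₀ hN0.ne', one_mul]
    _ ≤ 3 := h3

/-- The logarithm comes from `k₀`, the size from which the union bound works. The 5 is the 2 in `k₀`
plus the 3 that bounds the union bound. -/
theorem integral_optOn_le {p c₀ δ : ℝ} (hα : 0 ≤ α) (hβ : 0 < β) (hp : 0 < p)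
    (hc₀ : 0 < c₀) (hδ0 : 0 < δ)
    (hδ : δ ≤ p / 8) (hδ' : δ ≤ c₀ * (3 : ℝ) ^ (-α) * p / 32)
    (hsm : ∀ m, 0 < m → ∃ x, (D.law m).real (Set.Ioi x) = p ∧ c₀ * m ≤ x)
    (hP : 0 < P) (hL : ∀ j i, L.sender j ≠ L.receiver i) (hE : L.Equilength Finset.univ)
    (hC : C ∈ L.clusters o q) (hX : IsShadowing D L P α μ X) :
    ∫ ω, (optOn β (fun j i => X j i ω) C : ℝ) ∂μ ≤
      (∫ ω, ((clusterSelect L P α β (fun j i => X j i ω) C).card : ℝ) ∂μ + 1) / δ +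
        8 * Real.log C.card / p + 5 := by
  classical
  have hCne := LinkSet.nonempty_of_mem_clusters hC
  have hN : (1 : ℝ) ≤ C.card := by exact_mod_cast hCne.card_pos
  have hlog : 0 ≤ Real.log C.card := Real.log_nonneg hN
  set k₀ : ℝ := 8 * Real.log C.card / p + 2 with hk₀
  have hk2 : 2 ≤ k₀ := by
    have : 0 ≤ 8 * Real.log C.card / p := by positivity
    linarith
  let bad : Finset (Fin n) → Set Ω := fun S =>
    {ω | ((strongPairs L P α c₀ (fun j i => X j i ω) S).card : ℝ) ≤
      p * ((S.card : ℝ) * (S.card - 1)) / 4}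
  have hcardm : ∀ S : Finset (Fin n),
      Measurable fun ω => ((strongPairs L P α c₀ (fun j i => X j i ω) S).card : ℝ) := by
    intro S
    simp only [strongPairs, Finset.card_filter, Nat.cast_sum, Nat.cast_ite, Nat.cast_one,
      Nat.cast_zero]
    exact Finset.measurable_sum _ fun e _ => Measurable.ite
      (measurableSet_lt measurable_const (hX.measurable e.1 e.2)) measurable_const measurable_const
  have hbadm : ∀ S, MeasurableSet (bad S) := fun S => measurableSet_le (hcardm S) measurable_const
  have hint1 := integrable_card_clusterSelect (μ := μ) (L := L) (P := P) (α := α) (β := β)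
    (C := C) hX.measurable
  have hintbad : ∀ S, Integrable ((bad S).indicator (1 : Ω → ℝ)) μ := fun S =>
    (integrable_const (1 : ℝ)).indicator (hbadm S)
  have hintsum : Integrable (fun ω => ∑ S ∈ C.powerset.filter (fun S => k₀ ≤ (S.card : ℝ)),
      (bad S).indicator (1 : Ω → ℝ) ω) μ := integrable_finsetSum _ fun S _ => hintbad S
  have i1 : Integrable (fun ω =>
      (((clusterSelect L P α β (fun j i => X j i ω) C).card : ℝ) + 1) / δ) μ :=
    (hint1.add (integrable_const 1)).div_const δ
  have i2 : Integrable (fun ω =>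
      (((clusterSelect L P α β (fun j i => X j i ω) C).card : ℝ) + 1) / δ + k₀) μ :=
    i1.add (integrable_const k₀)
  have hle : ∫ ω, (optOn β (fun j i => X j i ω) C : ℝ) ∂μ ≤
      ∫ ω, ((((clusterSelect L P α β (fun j i => X j i ω) C).card : ℝ) + 1) / δ + k₀ +
        C.card * ∑ S ∈ C.powerset.filter (fun S => k₀ ≤ (S.card : ℝ)),
          (bad S).indicator (1 : Ω → ℝ) ω) ∂μ := by
    refine integral_mono_ae (integrable_optOn L P α hX.measurable)
      (i2.add (hintsum.const_mul _)) ?_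
    filter_upwards [hX.nonneg hL hP] with ω hω
    refine (optOn_le hα hβ hp hc₀ hδ0 hδ hδ' hP hL hE hC hω hk2).trans_eq ?_
    simp [bad, Set.indicator_apply]
  rw [integral_add i2 (hintsum.const_mul _), integral_add i1 (integrable_const k₀), integral_div,
    integral_add hint1 (integrable_const 1), integral_const_mul,
    integral_finsetSum _ fun S _ => hintbad S] at hle
  simp only [integral_const, probReal_univ, smul_eq_mul, mul_one, one_mul,
    integral_indicator_one (hbadm _)] at hle
  have h3 : (C.card : ℝ) * ∑ S ∈ C.powerset.filter (fun S => k₀ ≤ (S.card : ℝ)), μ.real (bad S) ≤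
      3 := le_trans (mul_le_mul_of_nonneg_left (Finset.sum_le_sum fun S _ =>
        measureReal_strongPairs_le hsm hP hL hX S) (Nat.cast_nonneg _))
        (card_mul_sum_exp_le hp hCne hk₀)
  linarith

end Cluster

/-! ### Lower bounds on the expected selection in a cluster -/

section GoodSelect

variable {n : ℕ} {L : LinkSet n} {P α β η : ℝ} {o : Plane} {q : ZMod 9 × ZMod 9}
  {C : Finset (Fin n)} {D : SSDistribution} {Ω : Type*} [MeasurableSpace Ω] {μ : Measure Ω}
  [IsProbabilityMeasure μ] {X : Fin n → Fin n → Ω → ℝ}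

theorem measurable_card_goodSelect (hX : ∀ j i, Measurable (X j i)) :
    Measurable fun ω => (goodSelect L P α β η (fun j i => X j i ω) C).card :=
  measurable_of_profile L P α β 0 η hX
    (F := fun x => (goodSelect L P α β η x C).card) fun x x' h => by rw [goodSelect_congr h]

theorem integrable_card_goodSelect (hX : ∀ j i, Measurable (X j i)) :
    Integrable (fun ω => ((goodSelect L P α β η (fun j i => X j i ω) C).card : ℝ)) μ :=
  integrable_natCast_of_le (measurable_card_goodSelect hX) (N := n)
    fun _ => (Finset.card_le_univ _).trans_eq (Fintype.card_fin n)

/-- By smoothness, any one fixed link reaches `c₀` times its mean with probability at least `p`, and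
then the good selection is nonempty. This bound absorbs the additive constants of each cluster. -/
theorem le_integral_card_goodSelect {p c₀ : ℝ} (hα : 0 ≤ α) (hβ : 0 ≤ β) (hc₀ : 0 < c₀)
    (hη : η ≤ β) (hη' : η ≤ c₀ * (2 : ℝ) ^ (-α))
    (hsm : ∀ m, 0 < m → ∃ x, (D.law m).real (Set.Ioi x) = p ∧ c₀ * m ≤ x)
    (hP : 0 < P) (hL : ∀ j i, L.sender j ≠ L.receiver i) (hE : L.Equilength C)
    (hC : C.Nonempty) (hX : IsShadowing D L P α μ X) :
    p ≤ ∫ ω, ((goodSelect L P α β η (fun j i => X j i ω) C).card : ℝ) ∂μ := by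
  obtain ⟨i, hi⟩ := hC
  have hm := LinkSet.gain_pos (α := α) hL hP i i
  let A := X i i ⁻¹' Set.Ioi (c₀ * L.gain P α i i)
  have hA : MeasurableSet A := hX.measurable i i measurableSet_Ioi
  have h1 : p ≤ μ.real A := by
    rw [hX.measureReal_preimage_Ioi]
    exact le_measureReal_Ioi_of_smooth hm (hsm _ hm)
  rw [← integral_indicator_one hA] at h1
  refine h1.trans (integral_mono ((integrable_const (1 : ℝ)).indicator hA)
    (integrable_card_goodSelect hX.measurable) fun ω => ?_)
  by_cases hω : ω ∈ A
  · rw [Set.indicator_of_mem hω, Pi.one_apply]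
    have h2 : c₀ * L.gain P α i i < X i i ω := hω
    have h3 := le_gain_self hα hP hL hE hi
    have hs := sender_power_pos (α := α) hP hL ⟨i, hi⟩
    have h4 : η * (P / L.minLen C ^ α) ≤ X i i ω := by
      have h5 := mul_le_mul_of_nonneg_right hη' hs.le
      have h6 := mul_le_mul_of_nonneg_left h3 hc₀.le
      rw [← mul_assoc] at h6
      linarith
    have h7 := goodSelect_nonempty (x := fun j i => X j i ω) hβ hP.le hη hi
      ((mul_pos hc₀ hm).trans h2) h4
    have h8 : 1 ≤ (goodSelect L P α β η (fun j i => X j i ω) C).card := h7.card_pos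
    exact Nat.one_le_cast.2 h8
  · rw [Set.indicator_of_notMem hω]
    positivity

theorem integral_card_clusterSelect_le (hβ : 0 ≤ β) (hη : η ≤ β) (hP : 0 ≤ P)
    (hX : ∀ j i, Measurable (X j i)) :
    ∫ ω, ((clusterSelect L P α β (fun j i => X j i ω) C).card : ℝ) ∂μ ≤
      ∫ ω, ((goodSelect L P α β η (fun j i => X j i ω) C).card : ℝ) ∂μ + 1 := by
  have h1 : ∫ ω, ((clusterSelect L P α β (fun j i => X j i ω) C).card : ℝ) ∂μ ≤
      ∫ ω, (((goodSelect L P α β η (fun j i => X j i ω) C).card : ℝ) + 1) ∂μ :=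
    integral_mono (integrable_card_clusterSelect hX)
      ((integrable_card_goodSelect hX).add (integrable_const 1)) fun ω => by
        have h := card_clusterSelect_le (L := L) (α := α) (x := fun j i => X j i ω)
          (C := C) hβ hP hη
        rw [← Nat.cast_add_one]
        exact Nat.cast_le.2 h
  rw [integral_add (integrable_card_goodSelect hX) (integrable_const 1)] at h1
  simpa using h1

/-- The expected number of selected links grows at least logarithmically. -/
theorem log_card_le {κ δ : ℝ} (hα : 0 ≤ α) (hβ : 0 ≤ β) (hδ0 : 0 < δ)
    (hδ : δ ≤ 1 / 4) (hδ' : 2 * β * δ ≤ (2 : ℝ) ^ (-α))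
    (hg : ∀ m, 0 < m → κ * Real.log C.card ≤ D.g m C.card)
    (hP : 0 < P) (hL : ∀ j i, L.sender j ≠ L.receiver i) (hE : L.Equilength C)
    (hC : C.Nonempty) (hX : IsShadowing D L P α μ X) :
    κ / 2 * Real.log C.card ≤
      (2 * ∫ ω, ((clusterSelect L P α β (fun j i => X j i ω) C).card : ℝ) ∂μ + 1) / δ + 4 := by
  classical
  set T := κ / 2 * Real.log C.card with hT
  have hN0 : (0 : ℝ) < C.card := by exact_mod_cast hC.card_pos
  set E := ∫ ω, ((clusterSelect L P α β (fun j i => X j i ω) C).card : ℝ) ∂μ with hEdef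
  have hE0 : 0 ≤ E := integral_nonneg fun ω => Nat.cast_nonneg _
  clear_value T E
  -- For `T ≤ 4` or `T ≤ 1 / δ` the additive constants suffice. Otherwise `T / 4 > 1`, and the
  -- failure probability `exp (-T / 4)` is at most `1 / 2`.
  by_cases hT4 : T ≤ 4
  · have : 0 ≤ (2 * E + 1) / δ := by positivity
    linarith
  by_cases hδT : δ * T ≤ 1
  · have : T ≤ (2 * E + 1) / δ := by
      rw [le_div_iff₀ hδ0]
      linarith
    linarith
  push Not at hT4 hδT
  have hprob : ∀ i ∈ C, T / C.card ≤ μ.real (X i i ⁻¹' Set.Ioi (T * L.gain P α i i)) := by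
    intro i hi
    have hm := LinkSet.gain_pos (α := α) hL hP i i
    rw [hX.measureReal_preimage_Ioi]
    -- The factor `1 / 2` in `T` provides the strict inequality `T < g`.
    refine div_le_tail hm (by linarith) (lt_of_lt_of_le ?_ (hg _ hm))
    linarith
  have hsum : T ≤ ∑ i ∈ C, μ.real (X i i ⁻¹' Set.Ioi (T * L.gain P α i i)) := by
    have := Finset.card_nsmul_le_sum _ _ _ hprob
    rwa [nsmul_eq_mul, mul_div_cancel₀ _ hN0.ne'] at this
  have hind : iIndepFun (fun i => X i i) μ :=
    hX.indep.precomp (g := fun i : Fin n => (i, i)) fun i j h => congrArg Prod.fst h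
  have htail := measureReal_card_filter_le_le hind (fun i => hX.measurable i i)
    (B := fun i => Set.Ioi (T * L.gain P α i i)) (fun i => measurableSet_Ioi) C hsum
  set A : Set Ω := {ω | ((C.filter fun i => X i i ω ∈ Set.Ioi (T * L.gain P α i i)).card : ℝ) ≤
    T / 4} with hA
  have hAm : MeasurableSet A := by
    refine measurableSet_le ?_ measurable_const
    simp only [Finset.card_filter, Nat.cast_sum, Nat.cast_ite, Nat.cast_one, Nat.cast_zero]
    exact Finset.measurable_sum _ fun i _ => Measurable.ite
      (measurableSet_lt measurable_const (hX.measurable i i)) measurable_const measurable_const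
  have hA2 : μ.real A ≤ 1 / 2 := by
    have h0 : μ.real A ≤ Real.exp (-(T / 4)) := by convert htail
    have h1 : Real.exp (-(T / 4)) ≤ Real.exp (-1) := Real.exp_le_exp.2 (by linarith)
    have h2 : Real.exp (-1) ≤ 1 / 2 := by
      rw [Real.exp_neg, ← one_div]
      refine one_div_le_one_div_of_le (by norm_num) ?_
      have := Real.add_one_le_exp (1 : ℝ)
      linarith
    linarith
  have hAc : 1 / 2 ≤ μ.real Aᶜ := by
    rw [probReal_compl_eq_one_sub hAm]
    linarith
  have hs := sender_power_pos (α := α) hP hL hC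
  -- Outside `A` more than `T / 4 ≥ δ T` links have strength above `2^(-α) s T ≥ 2 β s (δ T)`, the
  -- greedy threshold at size `δ T`.
  have hpt : ∀ ω, Aᶜ.indicator (fun _ => δ * T - 1) ω ≤
      ((clusterSelect L P α β (fun j i => X j i ω) C).card : ℝ) := by
    intro ω
    by_cases hω : ω ∈ Aᶜ
    · rw [Set.indicator_of_mem hω]
      have hω' : T / 4 < ((C.filter fun i =>
          X i i ω ∈ Set.Ioi (T * L.gain P α i i)).card : ℝ) := not_le.1 hω
      have hfl : (⌊δ * T⌋₊ : ℝ) ≤ δ * T := Nat.floor_le (by linarith)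
      have hr : ⌊δ * T⌋₊ ≤ (clusterSelect L P α β (fun j i => X j i ω) C).card := by
        refine le_card_clusterSelect hβ hP.le ?_
        have h3 : ⌊δ * T⌋₊ ≤ (C.filter fun i => X i i ω ∈ Set.Ioi (T * L.gain P α i i)).card := by
          have : (⌊δ * T⌋₊ : ℝ) ≤
              (C.filter fun i => X i i ω ∈ Set.Ioi (T * L.gain P α i i)).card := by
            nlinarith
          exact_mod_cast this
        refine h3.trans (Finset.card_le_card fun i hi => ?_)
        obtain ⟨hiC, hi⟩ := Finset.mem_filter.1 hi
        refine Finset.mem_filter.2 ⟨hiC, lt_of_le_of_lt ?_ (Set.mem_Ioi.1 hi)⟩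
        have h4 := le_gain_self hα hP hL hE hiC
        set s := P / L.minLen C ^ α
        calc 2 * β * s * ((⌊δ * T⌋₊ : ℝ) - 1) ≤ 2 * β * s * (δ * T) :=
              mul_le_mul_of_nonneg_left (by linarith) (by positivity)
          _ = (2 * β * δ) * (s * T) := by ring
          _ ≤ (2 : ℝ) ^ (-α) * (s * T) := mul_le_mul_of_nonneg_right hδ' (by nlinarith)
          _ = T * ((2 : ℝ) ^ (-α) * s) := by ring
          _ ≤ T * L.gain P α i i := mul_le_mul_of_nonneg_left h4 (by linarith)
      have h4 := Nat.lt_floor_add_one (δ * T)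
      have h5 : (⌊δ * T⌋₊ : ℝ) ≤ (clusterSelect L P α β (fun j i => X j i ω) C).card := by
        exact_mod_cast hr
      linarith
    · rw [Set.indicator_of_notMem hω]
      positivity
  have hint := integral_mono (μ := μ) ((integrable_const (δ * T - 1)).indicator hAm.compl)
    (integrable_card_clusterSelect hX.measurable) hpt
  rw [integral_indicator_const _ hAm.compl, smul_eq_mul, ← hEdef] at hint
  have h6 : T ≤ (2 * E + 1) / δ := by
    rw [le_div_iff₀ hδ0]
    nlinarith
  linarith

end GoodSelect

/-- In a cluster, the expected optimum is at most a constant factor larger than the expected number of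
links that the algorithm selects. -/
theorem exists_integral_optOn_le {α β p c₀ η : ℝ} (hα : 0 ≤ α) (hβ : 0 < β) (hp : 0 < p)
    (hc₀ : 0 < c₀) (hη : η ≤ β) (hη' : η ≤ c₀ * (2 : ℝ) ^ (-α)) (D : SSDistribution)
    (hsm : ∀ m, 0 < m → ∃ x, (D.law m).real (Set.Ioi x) = p ∧ c₀ * m ≤ x)
    (hg : D.HasLogGrowth) :
    ∃ K : ℝ, 0 < K ∧ ∀ (n : ℕ) (L : LinkSet n) (P : ℝ), 0 < P →
      (∀ j i, L.sender j ≠ L.receiver i) → L.Equilength Finset.univ →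
      ∀ (o : Plane) (q : ZMod 9 × ZMod 9), ∀ C ∈ L.clusters o q,
      ∀ {Ω : Type*} [MeasurableSpace Ω] (μ : Measure Ω) [IsProbabilityMeasure μ]
        (X : Fin n → Fin n → Ω → ℝ), IsShadowing D L P α μ X →
        ∫ ω, (optOn β (fun j i => X j i ω) C : ℝ) ∂μ ≤
          K * ∫ ω, ((goodSelect L P α β η (fun j i => X j i ω) C).card : ℝ) ∂μ := by
  obtain ⟨κ, hκ, N, hN⟩ := hg
  have h3 : (0 : ℝ) < (3 : ℝ) ^ (-α) := Real.rpow_pos_of_pos (by norm_num) _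
  have h2 : (0 : ℝ) < (2 : ℝ) ^ (-α) := Real.rpow_pos_of_pos (by norm_num) _
  set δ := min (p / 8) (c₀ * (3 : ℝ) ^ (-α) * p / 32) with hδ
  have hδ0 : 0 < δ := lt_min (by positivity) (by positivity)
  set δ' := min (1 / 4) ((2 : ℝ) ^ (-α) / (2 * β)) with hδ'
  have hδ'0 : 0 < δ' := lt_min (by positivity) (by positivity)
  have hδ'1 : 2 * β * δ' ≤ (2 : ℝ) ^ (-α) := by
    have := min_le_right (1 / 4) ((2 : ℝ) ^ (-α) / (2 * β))
    rw [← hδ', le_div_iff₀ (by positivity)] at this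
    linarith
  set M : ℝ := |Real.log N| with hM
  have hM0 : 0 ≤ M := abs_nonneg _
  -- The bounds combine to `a * G + b`, where `G` is the expected number of good links; `M` covers
  -- clusters with fewer than `N` links. Since `G ≥ p`, the constant `b` is at most `b / p * G`.
  let a : ℝ := 1 / δ + 8 / p * (2 / κ * (2 / δ'))
  let b : ℝ := 2 / δ + 8 / p * (M + 2 / κ * (3 / δ' + 4)) + 5
  have ha : 0 < a := by positivity
  have hb : 0 < b := by positivity
  refine ⟨a + b / p, by positivity, ?_⟩
  intro n L P hP hL hE o q C hC Ω _ μ _ X hX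
  have hCne := LinkSet.nonempty_of_mem_clusters hC
  have hCE : L.Equilength C := hE.mono (Finset.subset_univ _)
  have h4 := integral_optOn_le hα hβ hp hc₀ hδ0 (min_le_left _ _) (min_le_right _ _) hsm hP hL hE
    hC hX
  have h5 := integral_card_clusterSelect_le (μ := μ) (L := L) (α := α) (C := C) hβ.le hη hP.le
    hX.measurable
  have h6 := le_integral_card_goodSelect hα hβ.le hc₀ hη hη' hsm hP hL hCE hCne hX
  have hlogN : N ≤ C.card → _ := fun hNC =>
    log_card_le hα hβ.le hδ'0 (min_le_left _ _) hδ'1 (hN _ hNC) hP hL hCE hCne hX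
  have hC0 : (0 : ℝ) < C.card := by exact_mod_cast hCne.card_pos
  set O := ∫ ω, (optOn β (fun j i => X j i ω) C : ℝ) ∂μ
  set E := ∫ ω, ((clusterSelect L P α β (fun j i => X j i ω) C).card : ℝ) ∂μ
  set G := ∫ ω, ((goodSelect L P α β η (fun j i => X j i ω) C).card : ℝ) ∂μ
  clear_value O E G
  have hlog : Real.log C.card ≤ M + 2 / κ * ((2 * (G + 1) + 1) / δ' + 4) := by
    have hG0 : 0 ≤ G := hp.le.trans h6
    by_cases hNC : N ≤ C.card
    · have h7 := hlogN hNC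
      have h8 : (2 * E + 1) / δ' ≤ (2 * (G + 1) + 1) / δ' :=
        div_le_div_of_nonneg_right (by linarith) hδ'0.le
      have h9 := mul_le_mul_of_nonneg_left (h7.trans (add_le_add_left h8 4))
        (by positivity : 0 ≤ 2 / κ)
      have h10 : 2 / κ * (κ / 2 * Real.log C.card) = Real.log C.card := by
        field_simp
      linarith
    · have h7 : Real.log C.card ≤ Real.log N :=
        Real.log_le_log hC0 (by exact_mod_cast (not_le.1 hNC).le)
      have h8 : 0 ≤ 2 / κ * ((2 * (G + 1) + 1) / δ' + 4) := by positivity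
      linarith [le_abs_self (Real.log N)]
  have h7 : (E + 1) / δ ≤ (G + 2) / δ := div_le_div_of_nonneg_right (by linarith) hδ0.le
  have h8 : 8 * Real.log C.card / p ≤ 8 / p * (M + 2 / κ * ((2 * (G + 1) + 1) / δ' + 4)) := by
    rw [mul_div_right_comm]
    exact mul_le_mul_of_nonneg_left hlog (by positivity)
  have h9 : O ≤ a * G + b := by
    calc O ≤ (G + 2) / δ + 8 / p * (M + 2 / κ * ((2 * (G + 1) + 1) / δ' + 4)) + 5 := by linarith
      _ = a * G + b := by simp only [a, b]; ring
  have h10 : b ≤ b / p * G := by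
    rw [div_mul_eq_mul_div, le_div_iff₀ hp]
    exact mul_le_mul_of_nonneg_left h6 hb.le
  linarith

/-- The links with large strengths that the algorithm selects on the clusters of a class of the grid. -/
noncomputable def goodSelected {n : ℕ} (L : LinkSet n) (P α β η : ℝ) (o : Plane)
    (x : Fin n → Fin n → ℝ) (q : ZMod 9 × ZMod 9) : Finset (Fin n) :=
  (L.clusters o q).biUnion (goodSelect L P α β η x)

/-! ### Expected affectance on the good links -/

section Affectance

variable {n : ℕ} {L : LinkSet n} {P α β η : ℝ} {o : Plane} {q : ZMod 9 × ZMod 9}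
  {x x' : Fin n → Fin n → ℝ}

theorem goodSelect_subset {C : Finset (Fin n)} :
    goodSelect L P α β η x C ⊆ clusterSelect L P α β x C := by
  classical
  exact Finset.filter_subset _ _

theorem goodSelected_subset : goodSelected L P α β η o x q ⊆ selected L P α β o x q :=
  Finset.biUnion_mono fun _ _ => goodSelect_subset

theorem selected_subset : selected L P α β o x q ⊆ L.gridClass o q :=
  Finset.biUnion_subset.2 fun _ hC =>
    clusterSelect_subset.trans (LinkSet.subset_gridClass_of_mem_clusters hC)

theorem card_selected_le :
    (selected L P α β o x q).card ≤ ∑ C ∈ L.clusters o q, (clusterSelect L P α β x C).card :=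
  Finset.card_biUnion_le

theorem card_goodSelected : (goodSelected L P α β η o x q).card =
    ∑ C ∈ L.clusters o q, (goodSelect L P α β η x C).card :=
  Finset.card_biUnion fun _ hC _ hC' hne =>
    (LinkSet.disjoint_clusters hC hC' hne).mono (goodSelect_subset.trans clusterSelect_subset)
      (goodSelect_subset.trans clusterSelect_subset)

theorem goodSelected_congr {c : ℝ} (h : profile L P α β c η x = profile L P α β c η x') :
    goodSelected L P α β η o x q = goodSelected L P α β η o x' q := by
  have h1 : goodSelect L P α β η x = goodSelect L P α β η x' := funext (goodSelect_congr h)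
  simp only [goodSelected, h1]

theorem clusterSelect_congr_diag (h : ∀ i, x i i = x' i i) :
    clusterSelect L P α β x = clusterSelect L P α β x' := by
  funext C
  simp only [clusterSelect, byStrength, h]

theorem selected_congr_diag (h : ∀ i, x i i = x' i i) :
    selected L P α β o x q = selected L P α β o x' q := by
  simp only [selected, clusterSelect_congr_diag h]

theorem goodSelected_congr_diag (h : ∀ i, x i i = x' i i) :
    goodSelected L P α β η o x q = goodSelected L P α β η o x' q := by
  have h1 : goodSelect L P α β η x = goodSelect L P α β η x' := by
    funext C
    simp only [goodSelect, clusterSelect_congr_diag h, h]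
  simp only [goodSelected, h1]

/-- A sender of a class of the grid has bounded expected affectance on the good selected links. -/
theorem sum_gain_div_le (hα : 0 ≤ α) (hη : 0 < η) (hP : 0 < P)
    (hL : ∀ j i, L.sender j ≠ L.receiver i) (hE : L.Equilength Finset.univ) {Z : ℝ}
    (hZ : ∀ (F : Finset (ℤ × ℤ)) (w : ℤ × ℤ),
      ∑ z ∈ F, (1 + |((w.1 - z.1 : ℤ) : ℝ)|) ^ (-(α / 2)) *
        (1 + |((w.2 - z.2 : ℤ) : ℝ)|) ^ (-(α / 2)) ≤ Z)
    {i : Fin n} (hi : i ∈ L.gridClass o q) :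
    ∑ j ∈ goodSelected L P α β η o x q, L.gain P α i j / x j j ≤ 16 ^ α / η * Z := by
  classical
  set G := goodSelected L P α β η o x q with hG
  set l := L.minLen Finset.univ with hl
  have hl0 : 0 < l := LinkSet.minLen_pos hL ⟨i, Finset.mem_univ i⟩
  let w : ℤ × ℤ → ℝ := fun z => (1 + |(((L.square o i).1 - z.1 : ℤ) : ℝ)|) ^ (-(α / 2)) *
    (1 + |(((L.square o i).2 - z.2 : ℤ) : ℝ)|) ^ (-(α / 2))
  have hw0 : ∀ z, 0 < w z := fun z => by positivity
  have hmaps : ∀ j ∈ G, L.square o j ∈ G.image (L.square o) := fun j hj =>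
    Finset.mem_image_of_mem _ hj
  rw [← Finset.sum_fiberwise_of_maps_to hmaps]
  have hfiber : ∀ z ∈ G.image (L.square o),
      ∑ j ∈ G with L.square o j = z, L.gain P α i j / x j j ≤ 16 ^ α / η * w z := by
    intro z hz
    obtain ⟨j₀, hj₀, rfl⟩ := Finset.mem_image.1 hz
    obtain ⟨C, hC, hj₀C⟩ := Finset.mem_biUnion.1 hj₀
    have hCne : C.Nonempty := LinkSet.nonempty_of_mem_clusters hC
    set F := G.filter fun j => L.square o j = L.square o j₀ with hF
    have hFC : F ⊆ goodSelect L P α β η x C := by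
      intro j hj
      obtain ⟨hjG, hjz⟩ := Finset.mem_filter.1 hj
      obtain ⟨C', hC', hjC'⟩ := Finset.mem_biUnion.1 hjG
      have : C' = C := LinkSet.eq_of_square_eq hC' hC
        (clusterSelect_subset (goodSelect_subset hjC'))
        (clusterSelect_subset (goodSelect_subset hj₀C)) hjz
      exact this ▸ hjC'
    have hFpos : (0 : ℝ) < F.card :=
      Nat.cast_pos.2 (Finset.card_pos.2 ⟨j₀, Finset.mem_filter.2 ⟨hj₀, rfl⟩⟩)
    -- Good links of one square are as many as `F.card` and each has strength at least proportional
    -- to `F.card`, so the sum over the fibre does not depend on their number.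
    have hterm : ∀ j ∈ F, L.gain P α i j / x j j ≤ 16 ^ α / η * w (L.square o j₀) / F.card := by
      intro j hj
      have hjgood := Finset.mem_filter.1 (hFC hj)
      have hjC : j ∈ C := clusterSelect_subset hjgood.1
      have hjz := (Finset.mem_filter.1 hj).2
      obtain ⟨d1, d2, -⟩ := LinkSet.le_dist_sender_receiver hL hE hi
        (LinkSet.subset_gridClass_of_mem_clusters hC hjC)
      rw [hjz] at d1 d2
      have hd0 : 0 < dist (L.sender i) (L.receiver j) := dist_pos.2 (hL i j)
      set d := dist (L.sender i) (L.receiver j) with hd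
      have hFle : (F.card : ℝ) ≤ (clusterSelect L P α β x C).card := by
        exact_mod_cast Finset.card_le_card (hFC.trans goodSelect_subset)
      have hlC : L.minLen C ≤ 2 * l :=
        (LinkSet.minLen_le hjC).trans (hE.len_lt (Finset.mem_univ j)).le
      have hlC0 : 0 < L.minLen C := LinkSet.minLen_pos hL hCne
      have hs : P / (2 * l) ^ α ≤ P / L.minLen C ^ α :=
        div_le_div_of_nonneg_left hP.le (Real.rpow_pos_of_pos hlC0 _)
          (Real.rpow_le_rpow hlC0.le hlC hα)
      have hs0 : 0 < P / (2 * l) ^ α := div_pos hP (Real.rpow_pos_of_pos (by positivity) _)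
      have hxj : η * F.card * (P / (2 * l) ^ α) ≤ x j j := by
        refine le_trans ?_ hjgood.2
        exact mul_le_mul (mul_le_mul_of_nonneg_left hFle hη.le) hs hs0.le (by positivity)
      -- Each coordinate bound is used with exponent `α / 2`, so the decay becomes a product over
      -- the two coordinates, as in `hZ`.
      have hda : (l / 8) ^ α * (w (L.square o j₀))⁻¹ ≤ d ^ α := by
        have e : ∀ y : ℝ, 0 ≤ y → y ^ α = y ^ (α / 2) * y ^ (α / 2) := fun y hy => by
          rw [← Real.rpow_add_of_nonneg hy (by linarith) (by linarith), add_halves]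
        have f1 := Real.rpow_le_rpow (by positivity) d1 (by linarith : 0 ≤ α / 2)
        have f2 := Real.rpow_le_rpow (by positivity) d2 (by linarith : 0 ≤ α / 2)
        rw [Real.mul_rpow (by positivity) (by positivity)] at f1 f2
        have f3 := mul_le_mul f1 f2 (by positivity) (by positivity)
        rw [e d hd0.le, e (l / 8) (by positivity)]
        refine le_trans (le_of_eq ?_) f3
        simp only [w]
        rw [mul_inv, Real.rpow_neg (by positivity), Real.rpow_neg (by positivity), inv_inv, inv_inv]
        ring
      have hl8 : 0 < (l / 8) ^ α := Real.rpow_pos_of_pos (by positivity) _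
      have hgain : L.gain P α i j ≤ P / ((l / 8) ^ α * (w (L.square o j₀))⁻¹) :=
        div_le_div_of_nonneg_left hP.le (mul_pos hl8 (inv_pos.2 (hw0 _))) hda
      have h16 : (2 * l) ^ α = 16 ^ α * (l / 8) ^ α := by
        rw [← Real.mul_rpow (by norm_num) (by positivity)]
        congr 1
        ring
      calc L.gain P α i j / x j j
          ≤ P / ((l / 8) ^ α * (w (L.square o j₀))⁻¹) / (η * F.card * (P / (2 * l) ^ α)) :=
            div_le_div₀ (div_nonneg hP.le (mul_pos hl8 (inv_pos.2 (hw0 _))).le) hgain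
              (by positivity) hxj
        _ = 16 ^ α / η * w (L.square o j₀) / F.card := by
            have := (hw0 (L.square o j₀)).ne'
            rw [h16]
            field_simp
    refine (Finset.sum_le_card_nsmul _ _ _ hterm).trans_eq ?_
    rw [nsmul_eq_mul, mul_div_cancel₀ _ hFpos.ne']
  refine (Finset.sum_le_sum hfiber).trans ?_
  rw [← Finset.mul_sum]
  exact mul_le_mul_of_nonneg_left (hZ _ _) (by positivity)

/-- A bound that is free of randomness: inverse strengths of good links are bounded for `η > 0`,
which makes `selectWeight` integrable. -/
theorem le_of_mem_goodSelected (hη : 0 ≤ η) (hP : 0 < P) {j : Fin n}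
    (hj : j ∈ goodSelected L P α β η o x q) :
    η * (P / L.minLen {k ∈ L.gridClass o q | L.square o k = L.square o j} ^ α) ≤ x j j := by
  classical
  obtain ⟨C, hC, hjC⟩ := Finset.mem_biUnion.1 hj
  have hjg := Finset.mem_filter.1 hjC
  have hj' : j ∈ C := clusterSelect_subset hjg.1
  have hCe : C = {k ∈ L.gridClass o q | L.square o k = L.square o j} :=
    LinkSet.eq_of_square_eq hC (LinkSet.mem_clusters.2
      ⟨j, LinkSet.subset_gridClass_of_mem_clusters hC hj', rfl⟩) hj'
      (Finset.mem_filter.2 ⟨LinkSet.subset_gridClass_of_mem_clusters hC hj', rfl⟩) rfl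
  rw [← hCe]
  refine le_trans ?_ hjg.2
  have h1 : (1 : ℝ) ≤ (clusterSelect L P α β x C).card := by
    exact Nat.one_le_cast.2 (Finset.card_pos.2 ⟨j, hjg.1⟩)
  have hs : 0 ≤ P / L.minLen C ^ α :=
    div_nonneg hP.le (Real.rpow_nonneg (LinkSet.minLen_nonneg C) _)
  exact mul_le_mul_of_nonneg_right (le_mul_of_one_le_right hη h1) hs

variable {D : SSDistribution} {Ω : Type*} [MeasurableSpace Ω] {μ : Measure Ω}
  {X : Fin n → Fin n → Ω → ℝ}

open Classical in
/-- The inverse strength of link `j`, if `i` is selected and `j` is a good selected link. -/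
noncomputable def selectWeight (L : LinkSet n) (P α β η : ℝ) (o : Plane) (q : ZMod 9 × ZMod 9)
    (i j : Fin n) (x : Fin n → Fin n → ℝ) : ℝ :=
  if i ∈ selected L P α β o x q ∧ j ∈ goodSelected L P α β η o x q then (x j j)⁻¹ else 0

theorem selectWeight_congr_diag (h : ∀ i, x i i = x' i i) (i j : Fin n) :
    selectWeight L P α β η o q i j x = selectWeight L P α β η o q i j x' := by
  simp only [selectWeight, selected_congr_diag h, goodSelected_congr_diag h, h]

theorem measurable_selectWeight (hX : ∀ j i, Measurable (X j i)) (i j : Fin n) :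
    Measurable fun ω => selectWeight L P α β η o q i j (fun j i => X j i ω) := by
  classical
  have h := measurable_of_profile (γ := Prop) L P α β 0 η hX
    (F := fun x => i ∈ selected L P α β o x q ∧ j ∈ goodSelected L P α β η o x q)
    fun x x' h => by rw [selected_congr h, goodSelected_congr h]
  exact Measurable.ite (measurableSet_setOfPred.2 h) (hX j j).inv measurable_const

theorem selectWeight_nonneg (hβ : 0 ≤ β) (hP : 0 ≤ P) (i j : Fin n) :
    0 ≤ selectWeight L P α β η o q i j x := by
  unfold selectWeight
  split_ifs with h
  · exact inv_nonneg.2 (pos_of_mem_selected hβ hP (goodSelected_subset h.2)).le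
  · exact le_rfl

/-- Selection and weight read only the diagonal powers, and `X i j` is off the diagonal. -/
theorem indepFun_selectWeight (hX : IsShadowing D L P α μ X) {i j i' j' : Fin n} (hij : i ≠ j) :
    IndepFun (fun ω => selectWeight L P α β η o q i' j' (fun j i => X j i ω)) (X i j) μ := by
  classical
  let S : Finset (Fin n × Fin n) := Finset.univ.image fun a => (a, a)
  have hmem : ∀ a, (a, a) ∈ S := fun a => Finset.mem_image_of_mem _ (Finset.mem_univ a)
  have hdisj : Disjoint S {(i, j)} := by
    rw [Finset.disjoint_singleton_right]
    intro h
    obtain ⟨a, -, ha⟩ := Finset.mem_image.1 h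
    exact hij ((congrArg Prod.fst ha).symm.trans (congrArg Prod.snd ha))
  have h1 := hX.indep.indepFun_finset S {(i, j)} hdisj fun e => hX.measurable e.1 e.2
  -- Off-diagonal powers are replaced by 0, which leaves the weight unchanged and shows it as a
  -- function of the diagonal family.
  let Y : Fin n → Fin n → (S → ℝ) → ℝ := fun a b y =>
    if a = b then y ⟨(a, a), hmem a⟩ else 0
  have hY : ∀ a b, Measurable (Y a b) := fun a b => by
    by_cases h : a = b
    · simp only [Y, if_pos h]
      exact measurable_pi_apply _
    · simp only [Y, if_neg h]
      exact measurable_const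
  have h2 := h1.comp (measurable_selectWeight (L := L) (P := P) (α := α) (β := β) (η := η) (o := o)
    (q := q) hY i' j') (measurable_pi_apply (⟨(i, j), Finset.mem_singleton_self _⟩ :
      ({(i, j)} : Finset (Fin n × Fin n))))
  refine h2.congr (Filter.Eventually.of_forall fun ω => ?_) (Filter.Eventually.of_forall fun ω => rfl)
  exact selectWeight_congr_diag (fun a => by simp [Y]) i' j'

theorem sum_affectance_eq : ∑ j ∈ goodSelected L P α β η o x q,
      affectance x (selected L P α β o x q) j =
    ∑ j, ∑ i ∈ Finset.univ.erase j, selectWeight L P α β η o q i j x * x i j := by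
  classical
  rw [← Finset.sum_subset (Finset.subset_univ (goodSelected L P α β η o x q))]
  · refine Finset.sum_congr rfl fun j hj => ?_
    rw [affectance, ← Finset.sum_subset (Finset.erase_subset_erase j
      (Finset.subset_univ (selected L P α β o x q)))]
    · refine Finset.sum_congr rfl fun i hi => ?_
      rw [selectWeight, if_pos ⟨Finset.mem_of_mem_erase hi, hj⟩, div_eq_inv_mul]
    · intro i hi hi'
      have : i ∉ selected L P α β o x q := fun h =>
        hi' (Finset.mem_erase.2 ⟨Finset.ne_of_mem_erase hi, h⟩)
      simp [selectWeight, this]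
  · intro j _ hj
    simp [selectWeight, hj]

/-- With the interferences replaced by their means, the sum is regrouped by sender: each selected
sender contributes at most a constant. -/
theorem sum_selectWeight_mul_gain_le (hα : 0 ≤ α) (hβ : 0 ≤ β) (hη : 0 < η) (hP : 0 < P)
    (hL : ∀ j i, L.sender j ≠ L.receiver i) (hE : L.Equilength Finset.univ) {Z : ℝ}
    (hZ : ∀ (F : Finset (ℤ × ℤ)) (w : ℤ × ℤ),
      ∑ z ∈ F, (1 + |((w.1 - z.1 : ℤ) : ℝ)|) ^ (-(α / 2)) *
        (1 + |((w.2 - z.2 : ℤ) : ℝ)|) ^ (-(α / 2)) ≤ Z) :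
    ∑ j, ∑ i ∈ Finset.univ.erase j, selectWeight L P α β η o q i j x * L.gain P α i j ≤
      16 ^ α / η * Z * (selected L P α β o x q).card := by
  classical
  calc ∑ j, ∑ i ∈ Finset.univ.erase j, selectWeight L P α β η o q i j x * L.gain P α i j
      ≤ ∑ j, ∑ i, selectWeight L P α β η o q i j x * L.gain P α i j :=
        Finset.sum_le_sum fun j _ => Finset.sum_le_sum_of_subset_of_nonneg
          (Finset.erase_subset _ _) fun i _ _ =>
            mul_nonneg (selectWeight_nonneg hβ hP.le i j) (LinkSet.gain_pos hL hP i j).le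
    _ = ∑ i, ∑ j, selectWeight L P α β η o q i j x * L.gain P α i j := Finset.sum_comm
    _ = ∑ i ∈ selected L P α β o x q,
          ∑ j ∈ goodSelected L P α β η o x q, L.gain P α i j / x j j := by
        rw [← Finset.sum_subset (Finset.subset_univ (selected L P α β o x q))]
        · refine Finset.sum_congr rfl fun i hi => ?_
          rw [← Finset.sum_subset (Finset.subset_univ (goodSelected L P α β η o x q))]
          · refine Finset.sum_congr rfl fun j hj => ?_
            rw [selectWeight, if_pos ⟨hi, hj⟩, div_eq_inv_mul]
          · intro j _ hj
            simp [selectWeight, hj]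
        · intro i _ hi
          simp [selectWeight, hi]
    _ ≤ ∑ i ∈ selected L P α β o x q, 16 ^ α / η * Z :=
        Finset.sum_le_sum fun i hi => sum_gain_div_le hα hη hP hL hE hZ (selected_subset hi)
    _ = 16 ^ α / η * Z * (selected L P α β o x q).card := by
        rw [Finset.sum_const, nsmul_eq_mul, mul_comm]

variable [IsProbabilityMeasure μ]

theorem integrable_selectWeight (hβ : 0 ≤ β) (hη : 0 < η) (hP : 0 < P)
    (hL : ∀ j i, L.sender j ≠ L.receiver i) (hX : ∀ j i, Measurable (X j i)) (i j : Fin n) :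
    Integrable (fun ω => selectWeight L P α β η o q i j (fun j i => X j i ω)) μ := by
  refine Integrable.of_bound
    (C := (η * (P / L.minLen {k ∈ L.gridClass o q | L.square o k = L.square o j} ^ α))⁻¹)
    (measurable_selectWeight hX i j).aestronglyMeasurable (Filter.Eventually.of_forall fun ω => ?_)
  rw [Real.norm_of_nonneg (selectWeight_nonneg hβ hP.le i j)]
  unfold selectWeight
  split_ifs with h
  · have hj : j ∈ L.gridClass o q := selected_subset (goodSelected_subset h.2)
    have := sender_power_pos (α := α) hP hL
      (C := {k ∈ L.gridClass o q | L.square o k = L.square o j})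
      ⟨j, Finset.mem_filter.2 ⟨hj, rfl⟩⟩
    exact inv_anti₀ (mul_pos hη this) (le_of_mem_goodSelected hη.le hP h.2)
  · exact inv_nonneg.2 (mul_nonneg hη.le (div_nonneg hP.le
      (Real.rpow_nonneg (LinkSet.minLen_nonneg _) _)))

theorem integrable_card_selected (hX : ∀ j i, Measurable (X j i)) :
    Integrable (fun ω => ((selected L P α β o (fun j i => X j i ω) q).card : ℝ)) μ :=
  integrable_natCast_of_le (measurable_of_profile L P α β 0 0 hX
    (F := fun x => (selected L P α β o x q).card) fun x x' h => by rw [selected_congr h]) (N := n)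
    fun _ => (Finset.card_le_univ _).trans_eq (Fintype.card_fin n)

theorem integrable_selectWeight_mul (hβ : 0 ≤ β) (hη : 0 < η) (hP : 0 < P)
    (hL : ∀ j i, L.sender j ≠ L.receiver i) (hX : IsShadowing D L P α μ X) {i j : Fin n}
    (hij : i ≠ j) :
    Integrable (fun ω => selectWeight L P α β η o q i j (fun j i => X j i ω) * X i j ω) μ :=
  (indepFun_selectWeight hX hij).integrable_mul
    (integrable_selectWeight hβ hη hP hL hX.measurable i j) (hX.integrable hL hP i j)

theorem integrable_sum_affectance (hβ : 0 ≤ β) (hη : 0 < η) (hP : 0 < P)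
    (hL : ∀ j i, L.sender j ≠ L.receiver i) (hX : IsShadowing D L P α μ X) :
    Integrable (fun ω => ∑ j ∈ goodSelected L P α β η o (fun j i => X j i ω) q,
      affectance (fun j i => X j i ω) (selected L P α β o (fun j i => X j i ω) q) j) μ := by
  simp only [sum_affectance_eq]
  exact integrable_finsetSum _ fun j _ => integrable_finsetSum _ fun i hi =>
    integrable_selectWeight_mul hβ hη hP hL hX (Finset.ne_of_mem_erase hi)

/-- The expected total affectance on the good selected links is linear in the number of selected
links. -/
theorem integral_sum_affectance_le (hα : 0 ≤ α) (hβ : 0 ≤ β) (hη : 0 < η) (hP : 0 < P)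
    (hL : ∀ j i, L.sender j ≠ L.receiver i) (hE : L.Equilength Finset.univ) {Z : ℝ}
    (hZ : ∀ (F : Finset (ℤ × ℤ)) (w : ℤ × ℤ),
      ∑ z ∈ F, (1 + |((w.1 - z.1 : ℤ) : ℝ)|) ^ (-(α / 2)) *
        (1 + |((w.2 - z.2 : ℤ) : ℝ)|) ^ (-(α / 2)) ≤ Z)
    (hX : IsShadowing D L P α μ X) :
    ∫ ω, ∑ j ∈ goodSelected L P α β η o (fun j i => X j i ω) q,
        affectance (fun j i => X j i ω) (selected L P α β o (fun j i => X j i ω) q) j ∂μ ≤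
      16 ^ α / η * Z * ∫ ω, ((selected L P α β o (fun j i => X j i ω) q).card : ℝ) ∂μ := by
  have hw := fun i j => integrable_selectWeight (μ := μ) (α := α) (o := o) (q := q) hβ hη hP hL
    hX.measurable i j
  calc ∫ ω, ∑ j ∈ goodSelected L P α β η o (fun j i => X j i ω) q,
        affectance (fun j i => X j i ω) (selected L P α β o (fun j i => X j i ω) q) j ∂μ
      = ∑ j, ∑ i ∈ Finset.univ.erase j,
          ∫ ω, selectWeight L P α β η o q i j (fun j i => X j i ω) * X i j ω ∂μ := by
        simp only [sum_affectance_eq]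
        rw [integral_finsetSum _ fun j _ => integrable_finsetSum _ fun i hi =>
          integrable_selectWeight_mul hβ hη hP hL hX (Finset.ne_of_mem_erase hi)]
        exact Finset.sum_congr rfl fun j _ => integral_finsetSum _ fun i hi =>
          integrable_selectWeight_mul hβ hη hP hL hX (Finset.ne_of_mem_erase hi)
    _ = ∑ j, ∑ i ∈ Finset.univ.erase j,
          ∫ ω, selectWeight L P α β η o q i j (fun j i => X j i ω) * L.gain P α i j ∂μ := by
        refine Finset.sum_congr rfl fun j _ => Finset.sum_congr rfl fun i hi => ?_
        rw [integral_mul_const, ← hX.integral_eq hL hP i j]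
        exact (indepFun_selectWeight hX (Finset.ne_of_mem_erase hi)).integral_fun_mul_eq_mul_integral
          (hw i j).aestronglyMeasurable (hX.measurable i j).aestronglyMeasurable
    _ = ∫ ω, ∑ j, ∑ i ∈ Finset.univ.erase j,
          selectWeight L P α β η o q i j (fun j i => X j i ω) * L.gain P α i j ∂μ := by
        rw [integral_finsetSum _ fun j _ => integrable_finsetSum _ fun i _ =>
          (hw i j).mul_const _]
        exact Finset.sum_congr rfl fun j _ => (integral_finsetSum _ fun i _ =>
          (hw i j).mul_const _).symm
    _ ≤ ∫ ω, 16 ^ α / η * Z * ((selected L P α β o (fun j i => X j i ω) q).card : ℝ) ∂μ :=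
        integral_mono (integrable_finsetSum _ fun j _ => integrable_finsetSum _ fun i _ =>
          (hw i j).mul_const _) ((integrable_card_selected hX.measurable).const_mul _)
          fun ω => sum_selectWeight_mul_gain_le hα hβ hη hP hL hE hZ
    _ = _ := integral_const_mul _ _

end Affectance

/-! ### Sparsification and the final comparison -/

section Main

variable {n : ℕ} {L : LinkSet n} {P α β η c : ℝ} {o : Plane} {q : ZMod 9 × ZMod 9}
  {x : Fin n → Fin n → ℝ}

theorem IsFeasible.mono (hβ : 0 ≤ β) (hx : ∀ j i, 0 ≤ x j i) {S T : Finset (Fin n)}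
    (hS : IsFeasible β x S) (h : T ⊆ S) : IsFeasible β x T := fun i hi =>
  (mul_le_mul_of_nonneg_left (Finset.sum_le_sum_of_subset_of_nonneg
    (Finset.erase_subset_erase i h) fun j _ _ => hx j i) hβ).trans_lt (hS i (h hi))

theorem IsFeasible.card_le_optOn {S C : Finset (Fin n)} (hSC : S ⊆ C) (h : IsFeasible β x S) :
    S.card ≤ optOn β x C := by
  classical
  exact Finset.le_sup (f := Finset.card) (Finset.mem_filter.2 ⟨Finset.mem_univ S, hSC, h⟩)

/-- The optimum is at most the sum of the optima of the clusters. -/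
theorem opt_le_sum_optOn (L : LinkSet n) (o : Plane) (hβ : 0 ≤ β) (hx : ∀ j i, 0 ≤ x j i) :
    opt β x ≤ ∑ q, ∑ C ∈ L.clusters o q, optOn β x C := by
  classical
  refine Finset.sup_le fun S hS => ?_
  have hS' := (Finset.mem_filter.1 hS).2
  have hcover : S ⊆ Finset.univ.biUnion fun q => (L.clusters o q).biUnion fun C => S ∩ C := by
    intro i hi
    have hiq : i ∈ L.gridClass o (((L.square o i).1 : ZMod 9), ((L.square o i).2 : ZMod 9)) :=
      Finset.mem_filter.2 ⟨Finset.mem_univ i, rfl⟩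
    rw [← LinkSet.biUnion_clusters] at hiq
    obtain ⟨C, hC, hiC⟩ := Finset.mem_biUnion.1 hiq
    exact Finset.mem_biUnion.2 ⟨_, Finset.mem_univ _,
      Finset.mem_biUnion.2 ⟨C, hC, Finset.mem_inter.2 ⟨hi, hiC⟩⟩⟩
  calc S.card ≤ _ := Finset.card_le_card hcover
    _ ≤ ∑ q, ((L.clusters o q).biUnion fun C => S ∩ C).card := Finset.card_biUnion_le
    _ ≤ ∑ q, ∑ C ∈ L.clusters o q, (S ∩ C).card :=
        Finset.sum_le_sum fun q _ => Finset.card_biUnion_le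
    _ ≤ ∑ q, ∑ C ∈ L.clusters o q, optOn β x C :=
        Finset.sum_le_sum fun q _ => Finset.sum_le_sum fun C _ =>
          (hS'.mono hβ hx Finset.inter_subset_left).card_le_optOn Finset.inter_subset_right

/-- Links are removed from the good selected set only if their affectance is large. -/
theorem card_goodSelected_le (hc : 0 < c) (hx : ∀ j i, 0 ≤ x j i) :
    ((goodSelected L P α β η o x q).card : ℝ) ≤ (sparsified L P α β c o x q).card +
      (∑ j ∈ goodSelected L P α β η o x q, affectance x (selected L P α β o x q) j) / (2 * c) := by
  classical
  set G := goodSelected L P α β η o x q with hG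
  set S := selected L P α β o x q
  have ha : ∀ j, 0 ≤ affectance x S j := fun j =>
    Finset.sum_nonneg fun i _ => div_nonneg (hx i j) (hx j j)
  have h1 : G.filter (fun j => affectance x S j < 2 * c) ⊆ sparsified L P α β c o x q := by
    intro j hj
    obtain ⟨h2, h3⟩ := Finset.mem_filter.1 hj
    exact Finset.mem_filter.2 ⟨goodSelected_subset h2, h3⟩
  -- Markov's inequality for the counting measure on `G`.
  have h2 : ((G.filter fun j => ¬ affectance x S j < 2 * c).card : ℝ) ≤
      (∑ j ∈ G, affectance x S j) / (2 * c) := by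
    rw [le_div_iff₀ (by positivity), ← nsmul_eq_mul]
    refine (Finset.card_nsmul_le_sum _ (affectance x S) _ fun j hj =>
      not_lt.1 (Finset.mem_filter.1 hj).2).trans ?_
    exact Finset.sum_le_sum_of_subset_of_nonneg (Finset.filter_subset _ _) fun j _ _ => ha j
  have h3 : (G.card : ℝ) = (G.filter fun j => affectance x S j < 2 * c).card +
      (G.filter fun j => ¬ affectance x S j < 2 * c).card := by
    exact_mod_cast (Finset.card_filter_add_card_filter_not _).symm
  have h4 : ((G.filter fun j => affectance x S j < 2 * c).card : ℝ) ≤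
      (sparsified L P α β c o x q).card := Nat.cast_le.2 (Finset.card_le_card h1)
  linarith

variable {D : SSDistribution} {Ω : Type*} [MeasurableSpace Ω] {μ : Measure Ω}
  [IsProbabilityMeasure μ] {X : Fin n → Fin n → Ω → ℝ}

theorem integrable_card_sparsified (hX : ∀ j i, Measurable (X j i)) :
    Integrable (fun ω => ((sparsified L P α β c o (fun j i => X j i ω) q).card : ℝ)) μ :=
  integrable_natCast_of_le (measurable_of_profile L P α β c 0 hX
    (F := fun x => (sparsified L P α β c o x q).card) fun x x' h => by rw [sparsified_congr h])
    (N := n) fun _ => (Finset.card_le_univ _).trans_eq (Fintype.card_fin n)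

theorem integrable_opt (L : LinkSet n) (P α : ℝ) (hX : ∀ j i, Measurable (X j i)) :
    Integrable (fun ω => (opt β (fun j i => X j i ω) : ℝ)) μ :=
  integrable_natCast_of_le (measurable_of_profile L P α β 0 0 hX
    (F := fun x => opt β x) fun _ _ h => opt_congr h) fun _ => opt_le

theorem integral_card_goodSelected (hX : ∀ j i, Measurable (X j i)) :
    ∫ ω, ((goodSelected L P α β η o (fun j i => X j i ω) q).card : ℝ) ∂μ =
      ∑ C ∈ L.clusters o q, ∫ ω, ((goodSelect L P α β η (fun j i => X j i ω) C).card : ℝ) ∂μ := by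
  simp only [card_goodSelected, Nat.cast_sum]
  exact integral_finsetSum _ fun C _ => integrable_card_goodSelect hX

theorem integrable_card_goodSelected (hX : ∀ j i, Measurable (X j i)) :
    Integrable (fun ω => ((goodSelected L P α β η o (fun j i => X j i ω) q).card : ℝ)) μ := by
  simp only [card_goodSelected, Nat.cast_sum]
  exact integrable_finsetSum _ fun C _ => integrable_card_goodSelect hX

/-- Each cluster has at most one selected link that is not good, and at least `p` good links in
expectation to pay for it. -/
theorem integral_card_selected_le {p c₀ : ℝ} (hα : 0 ≤ α) (hβ : 0 ≤ β) (hp : 0 < p)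
    (hc₀ : 0 < c₀) (hη : η ≤ β) (hη' : η ≤ c₀ * (2 : ℝ) ^ (-α))
    (hsm : ∀ m, 0 < m → ∃ x, (D.law m).real (Set.Ioi x) = p ∧ c₀ * m ≤ x)
    (hP : 0 < P) (hL : ∀ j i, L.sender j ≠ L.receiver i) (hE : L.Equilength Finset.univ)
    (hX : IsShadowing D L P α μ X) :
    ∫ ω, ((selected L P α β o (fun j i => X j i ω) q).card : ℝ) ∂μ ≤
      (1 + 1 / p) * ∫ ω, ((goodSelected L P α β η o (fun j i => X j i ω) q).card : ℝ) ∂μ := by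
  calc ∫ ω, ((selected L P α β o (fun j i => X j i ω) q).card : ℝ) ∂μ
      ≤ ∫ ω, ∑ C ∈ L.clusters o q,
          ((clusterSelect L P α β (fun j i => X j i ω) C).card : ℝ) ∂μ :=
        integral_mono (integrable_card_selected hX.measurable)
          (integrable_finsetSum _ fun C _ => integrable_card_clusterSelect hX.measurable)
          fun ω => by
            simp only [← Nat.cast_sum]
            exact Nat.cast_le.2 card_selected_le
    _ = ∑ C ∈ L.clusters o q,
          ∫ ω, ((clusterSelect L P α β (fun j i => X j i ω) C).card : ℝ) ∂μ :=
        integral_finsetSum _ fun C _ => integrable_card_clusterSelect hX.measurable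
    _ ≤ ∑ C ∈ L.clusters o q,
          (1 + 1 / p) * ∫ ω, ((goodSelect L P α β η (fun j i => X j i ω) C).card : ℝ) ∂μ := by
        refine Finset.sum_le_sum fun C hC => ?_
        have h1 := integral_card_clusterSelect_le (μ := μ) (L := L) (α := α) (C := C) hβ hη hP.le
          hX.measurable
        have h2 := le_integral_card_goodSelect hα hβ hc₀ hη hη' hsm hP hL
          (hE.mono (Finset.subset_univ C)) (LinkSet.nonempty_of_mem_clusters hC) hX
        set G := ∫ ω, ((goodSelect L P α β η (fun j i => X j i ω) C).card : ℝ) ∂μ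
        have h3 : 1 ≤ 1 / p * G := by
          rw [one_div_mul_eq_div, le_div_iff₀ hp]
          linarith
        linarith
    _ = _ := by rw [← Finset.mul_sum, integral_card_goodSelected hX.measurable]

/-- This `c` makes the expected total affectance at most `c` times the expected number of good
links, so removal at level `2 * c` costs at most half of them in expectation. -/
theorem integral_card_goodSelected_le {p c₀ Z : ℝ} (hα : 0 ≤ α) (hβ : 0 ≤ β) (hp : 0 < p)
    (hc₀ : 0 < c₀) (hη0 : 0 < η) (hη : η ≤ β) (hη' : η ≤ c₀ * (2 : ℝ) ^ (-α))
    (hsm : ∀ m, 0 < m → ∃ x, (D.law m).real (Set.Ioi x) = p ∧ c₀ * m ≤ x)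
    (hZ0 : 0 < Z) (hZ : ∀ (F : Finset (ℤ × ℤ)) (w : ℤ × ℤ),
      ∑ z ∈ F, (1 + |((w.1 - z.1 : ℤ) : ℝ)|) ^ (-(α / 2)) *
        (1 + |((w.2 - z.2 : ℤ) : ℝ)|) ^ (-(α / 2)) ≤ Z)
    (hP : 0 < P) (hL : ∀ j i, L.sender j ≠ L.receiver i) (hE : L.Equilength Finset.univ)
    (hX : IsShadowing D L P α μ X) (hc : c = 16 ^ α / η * Z * (1 + 1 / p)) :
    ∫ ω, ((goodSelected L P α β η o (fun j i => X j i ω) q).card : ℝ) ∂μ ≤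
      2 * ∫ ω, ((sparsified L P α β c o (fun j i => X j i ω) q).card : ℝ) ∂μ := by
  have hc0 : 0 < c := by rw [hc]; positivity
  have hA := integrable_sum_affectance (o := o) (q := q) hβ hη0 hP hL hX
  have hR := integrable_card_sparsified (μ := μ) (L := L) (P := P) (α := α) (β := β) (c := c)
    (o := o) (q := q) hX.measurable
  have h1 : ∫ ω, ((goodSelected L P α β η o (fun j i => X j i ω) q).card : ℝ) ∂μ ≤
      ∫ ω, (((sparsified L P α β c o (fun j i => X j i ω) q).card : ℝ) +
        (∑ j ∈ goodSelected L P α β η o (fun j i => X j i ω) q,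
          affectance (fun j i => X j i ω) (selected L P α β o (fun j i => X j i ω) q) j) /
            (2 * c)) ∂μ := by
    refine integral_mono_ae (integrable_card_goodSelected hX.measurable)
      (hR.add (hA.div_const _)) ?_
    filter_upwards [hX.nonneg hL hP] with ω hω
    exact card_goodSelected_le hc0 hω
  rw [integral_add hR (hA.div_const _), integral_div, mul_comm 2 c] at h1
  have h2 := integral_sum_affectance_le (o := o) (q := q) hα hβ hη0 hP hL hE hZ hX
  have h3 := integral_card_selected_le (o := o) (q := q) hα hβ hp hc₀ hη hη' hsm hP hL hE hX
  have h4 := mul_le_mul_of_nonneg_left h3 (by positivity : 0 ≤ 16 ^ α / η * Z)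
  rw [← mul_assoc, ← hc] at h4
  have h5 := div_le_div_of_nonneg_right (h2.trans h4) (by positivity : 0 ≤ 2 * c)
  rw [mul_comm 2 c, mul_div_mul_left _ _ hc0.ne'] at h5
  linarith

theorem IsRun.integrable {ALG : Ω → Finset (Fin n)} (h : IsRun L P α β c o μ X ALG) :
    Integrable (fun ω => ((ALG ω).card : ℝ)) μ := by
  have hm : Measurable fun ω => (ALG ω).card := by
    intro t _
    have : (fun ω => (ALG ω).card) ⁻¹' t =
        ⋃ A ∈ {A : Finset (Fin n) | A.card ∈ t}, {ω | ALG ω = A} := by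
      ext ω
      simp
    rw [this]
    exact MeasurableSet.biUnion (Set.to_countable _) fun A _ => h.measurable A
  exact integrable_natCast_of_le hm (N := n)
    fun _ => (Finset.card_le_univ _).trans_eq (Fintype.card_fin n)

theorem IsRun.integral_le {ALG : Ω → Finset (Fin n)} (h : IsRun L P α β c o μ X ALG)
    (hX : ∀ j i, Measurable (X j i)) :
    ∫ ω, ((ALG ω).card : ℝ) ∂μ ≤ ∫ ω, (opt β (fun j i => X j i ω) : ℝ) ∂μ := by
  refine integral_mono_ae h.integrable (integrable_opt L P α hX) ?_
  filter_upwards [h.output] with ω hω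
  exact Nat.cast_le.2 hω.isFeasible.card_le_opt

theorem IsRun.sum_integral_le {ALG : Ω → Finset (Fin n)} (h : IsRun L P α β c o μ X ALG)
    (hX : ∀ j i, Measurable (X j i)) :
    ∑ q, ∫ ω, ((sparsified L P α β c o (fun j i => X j i ω) q).card : ℝ) ∂μ ≤
      81 * ⌈4 * c * β⌉₊ * ∫ ω, ((ALG ω).card : ℝ) ∂μ := by
  rw [← integral_finsetSum _ fun q _ => integrable_card_sparsified hX, ← integral_const_mul]
  refine integral_mono_ae (integrable_finsetSum _ fun q _ => integrable_card_sparsified hX)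
    (h.integrable.const_mul _) ?_
  filter_upwards [h.output] with ω hω
  exact_mod_cast hω.sum_card_sparsified_le

theorem integral_opt_le (o : Plane) (hβ : 0 ≤ β) (hP : 0 < P)
    (hL : ∀ j i, L.sender j ≠ L.receiver i) (hX : IsShadowing D L P α μ X) :
    ∫ ω, (opt β (fun j i => X j i ω) : ℝ) ∂μ ≤
      ∑ q, ∑ C ∈ L.clusters o q, ∫ ω, (optOn β (fun j i => X j i ω) C : ℝ) ∂μ := by
  have hi := fun C : Finset (Fin n) =>
    integrable_optOn (μ := μ) (β := β) (C := C) L P α hX.measurable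
  have h1 : ∫ ω, (opt β (fun j i => X j i ω) : ℝ) ∂μ ≤
      ∫ ω, ∑ q, ∑ C ∈ L.clusters o q, (optOn β (fun j i => X j i ω) C : ℝ) ∂μ := by
    refine integral_mono_ae (integrable_opt L P α hX.measurable)
      (integrable_finsetSum _ fun q _ => integrable_finsetSum _ fun C _ => hi C) ?_
    filter_upwards [hX.nonneg hL hP] with ω hω
    exact_mod_cast opt_le_sum_optOn L o hβ hω
  rw [integral_finsetSum _ fun q _ => integrable_finsetSum _ fun C _ => hi C] at h1
  refine h1.trans_eq (Finset.sum_congr rfl fun q _ => integral_finsetSum _ fun C _ => hi C)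

end Main

theorem mainTheorem2 (α β p : ℝ) (hα : 2 < α) (hβ : 1 ≤ β) (hp0 : 0 < p) (hp1 : p < 1)
    (D : SSDistribution) (hD : D.IsSmooth p) (hg : D.HasLogGrowth) :
    ∃ c : ℝ, 0 < c ∧ ∃ A : ℝ, 0 < A ∧ ∃ B : ℝ, 0 < B ∧
      ∀ (n : ℕ) (L : LinkSet n) (P : ℝ), 0 < P →
        (∀ j i, L.sender j ≠ L.receiver i) → L.Equilength Finset.univ →
        ∀ o : Plane,
          (∀ q, L.IsWellSeparated (L.gridClass o q) (L.clusters o q)) ∧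
          ∀ (Ω : Type*) [MeasurableSpace Ω] (μ : Measure Ω) [IsProbabilityMeasure μ]
            (X : Fin n → Fin n → Ω → ℝ), IsShadowing D L P α μ X →
            (∃ ALG : Ω → Finset (Fin n), IsRun L P α β c o μ X ALG) ∧
            ∀ ALG : Ω → Finset (Fin n), IsRun L P α β c o μ X ALG →
              A * ∫ ω, (opt β (fun j i => X j i ω) : ℝ) ∂μ ≤ ∫ ω, ((ALG ω).card : ℝ) ∂μ ∧
              ∫ ω, ((ALG ω).card : ℝ) ∂μ ≤ B * ∫ ω, (opt β (fun j i => X j i ω) : ℝ) ∂μ := by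
  obtain ⟨c₀, hc₀, hsm⟩ := hD
  have hα0 : 0 ≤ α := by linarith
  have hβ0 : 0 < β := by linarith
  have h2 : (0 : ℝ) < (2 : ℝ) ^ (-α) := Real.rpow_pos_of_pos (by norm_num) _
  obtain ⟨η, hη0, hη, hη'⟩ : ∃ η : ℝ, 0 < η ∧ η ≤ β ∧ η ≤ c₀ * (2 : ℝ) ^ (-α) :=
    ⟨min β (c₀ * (2 : ℝ) ^ (-α)), lt_min hβ0 (mul_pos hc₀ h2), min_le_left _ _, min_le_right _ _⟩
  obtain ⟨K, hK, hopt⟩ := exists_integral_optOn_le hα0 hβ0 hp0 hc₀ hη hη' D hsm hg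
  obtain ⟨Z, hZ0, hZ⟩ := exists_sum_grid_le (s := α / 2) (by linarith)
  obtain ⟨c, hc⟩ : ∃ c : ℝ, c = 16 ^ α / η * Z * (1 + 1 / p) := ⟨_, rfl⟩
  have hc0 : 0 < c := by rw [hc]; positivity
  have hk : (0 : ℝ) < ⌈4 * c * β⌉₊ := Nat.cast_pos.2 (Nat.ceil_pos.2 (by positivity))
  -- The losses multiply: `K` from optimum to good links, 2 from sparsification, 81 from the choice
  -- of a class, `⌈4 * c * β⌉₊` from the choice of a part.
  refine ⟨c, hc0, (K * (2 * (81 * ⌈4 * c * β⌉₊)))⁻¹, by positivity, 1, one_pos, ?_⟩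
  intro n L P hP hL hE o
  refine ⟨LinkSet.isWellSeparated_gridClass hL hE o, ?_⟩
  intro Ω _ μ _ X hX
  refine ⟨exists_isRun hX.measurable (hX.nonneg hL hP) hβ0 hc0 hP.le, fun ALG hALG => ⟨?_, ?_⟩⟩
  · rw [inv_mul_le_iff₀ (by positivity)]
    calc ∫ ω, (opt β (fun j i => X j i ω) : ℝ) ∂μ
        ≤ ∑ q, ∑ C ∈ L.clusters o q, ∫ ω, (optOn β (fun j i => X j i ω) C : ℝ) ∂μ :=
          integral_opt_le o hβ0.le hP hL hX
      _ ≤ ∑ q, ∑ C ∈ L.clusters o q,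
            K * ∫ ω, ((goodSelect L P α β η (fun j i => X j i ω) C).card : ℝ) ∂μ :=
          Finset.sum_le_sum fun q _ => Finset.sum_le_sum fun C hC =>
            hopt n L P hP hL hE o q C hC μ X hX
      _ = K * ∑ q, ∫ ω, ((goodSelected L P α β η o (fun j i => X j i ω) q).card : ℝ) ∂μ := by
          simp only [integral_card_goodSelected hX.measurable, Finset.mul_sum]
      _ ≤ K * ∑ q, 2 * ∫ ω, ((sparsified L P α β c o (fun j i => X j i ω) q).card : ℝ) ∂μ :=
          mul_le_mul_of_nonneg_left (Finset.sum_le_sum fun q _ =>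
            integral_card_goodSelected_le hα0 hβ0.le hp0 hc₀ hη0 hη hη' hsm hZ0 hZ hP hL hE hX hc)
            hK.le
      _ ≤ K * (2 * (81 * ⌈4 * c * β⌉₊ * ∫ ω, ((ALG ω).card : ℝ) ∂μ)) := by
          rw [← Finset.mul_sum]
          exact mul_le_mul_of_nonneg_left (mul_le_mul_of_nonneg_left
            (hALG.sum_integral_le hX.measurable) two_pos.le) hK.le
      _ = K * (2 * (81 * ⌈4 * c * β⌉₊)) * ∫ ω, ((ALG ω).card : ℝ) ∂μ := by ring
  · rw [one_mul]
    exact hALG.integral_le hX.measurable
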